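/- Let $R$ be a commutative artinian ring and $\Lambda$ an artin $R$-algebra, i.e. an $R$-algebra that is finitely generated as an $R$-module. Let $\mathrm{mod}\,\Lambda$ be the category of finitely generated $\Lambda$-modules, and let $D=\mathrm{Hom}_R(-,E)$, where $E$ is an injective envelope of the $R$-module $R/\mathrm{rad}\,R$. Let $n\ge 1$ and let $\mathcal M\subseteq \mathrm{mod}\,\Lambda$ be an $n$-cluster tilting subcategory: a full additive subcategory that is functorially finite, generating and cogenerating, and satisfies $$\mathcal M=\{X \mid \mathrm{Ext}^i_\Lambda(\mathcal M,X)=0 \text{ for } 0<i<n\}=\{X \mid \mathrm{Ext}^i_\Lambda(X,\mathcal M)=0 \text{ for } 0<i<n\}.$$ Let $\underline{\mathcal M}$ (respectively $\overline{\mathcal M}$) be the quotient of $\mathcal M$ by the ideal of morphisms that factor through a projective (respectively injective) object of $\mathrm{mod}\,\Lambda$. Then there are an equivalence of categories $\tau_n:\underline{\mathcal M}\to\overline{\mathcal M}$ and isomorphisms of $R$-modules $$\mathrm{Ext}^n_\Lambda(X,Y)\;\cong\; D\,\overline{\mathcal M}(Y,\tau_n X)\qquad (X,Y\in\mathcal M),$$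 natural in both $X$ and $Y$. -/

import Mathlib

open CategoryTheory CategoryTheory.Limits CategoryTheory.Abelian

universe u v

noncomputable section

namespace NAR

/-! ### `n`-cluster tilting subcategories of an abelian category

A full subcategory of `A` is given by the property `M : ObjectProperty A` of its objects. -/

section ClusterTilting

variable {A : Type u} [Category.{v} A]

/-- A right `M`-approximation of `X`: a morphism `p : N ⟶ X` with `N ∈ M` such that every
morphism from an object of `M` to `X` factors through `p`. -/
def IsRightApproximation (M : ObjectProperty A) {N X : A} (p : N ⟶ X) : Prop :=
  M N ∧ ∀ (N' : A) (g : N' ⟶ X), M N' → ∃ h : N' ⟶ N, h ≫ p = g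

/-- A left `M`-approximation of `X`: a morphism `i : X ⟶ N` with `N ∈ M` such that every
morphism from `X` to an object of `M` factors through `i`. -/
def IsLeftApproximation (M : ObjectProperty A) {X N : A} (i : X ⟶ N) : Prop :=
  M N ∧ ∀ (N' : A) (g : X ⟶ N'), M N' → ∃ h : N ⟶ N', i ≫ h = g

/-- `M` is an `n`-cluster tilting subcategory of the abelian category `A`: it is an additive
subcategory which is functorially finite, generating and cogenerating, and
`M = {X | Extⁱ(M, X) = 0 for 0 < i < n} = {X | Extⁱ(X, M) = 0 for 0 < i < n}`. -/
structure IsNClusterTilting [Abelian A] [HasExt.{max u v} A] (n : ℕ) (M : ObjectProperty A) :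
    Prop where
  zero : M.ContainsZero
  biprod : ∀ X Y : A, M X → M Y → M (X ⊞ Y)
  contravariantlyFinite : ∀ X : A, ∃ (N : A) (p : N ⟶ X), IsRightApproximation M p
  covariantlyFinite : ∀ X : A, ∃ (N : A) (i : X ⟶ N), IsLeftApproximation M i
  generating : ∀ X : A, ∃ (N : A) (p : N ⟶ X), M N ∧ Epi p
  cogenerating : ∀ X : A, ∃ (N : A) (i : X ⟶ N), M N ∧ Mono i
  right_perp : ∀ X : A, M X ↔
    ∀ N : A, M N → ∀ i : ℕ, 0 < i → i < n → Subsingleton (Ext.{max u v} N X i)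
  left_perp : ∀ X : A, M X ↔
    ∀ N : A, M N → ∀ i : ℕ, 0 < i → i < n → Subsingleton (Ext.{max u v} X N i)

end ClusterTilting

/-! ### Quotient of a full subcategory by the morphisms factoring through a class of objects -/

section StableCategory

open scoped ZeroObject

variable {A : Type u} [Category.{v} A] [Preadditive A]

/-- Two morphisms of the full subcategory `M` are identified when their difference factors
through an object with the property `P`. -/
def factorRel (M P : ObjectProperty A) : HomRel M.FullSubcategory :=
  fun X Y f g => ∃ (K : A) (a : X.obj ⟶ K) (b : K ⟶ Y.obj), P K ∧ a ≫ b = f.hom - g.hom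

theorem factorRel_smul (M P : ObjectProperty A) {R : Type*} [Ring R] [Linear R A] (r : R) {X Y : M.FullSubcategory}
    (f₁ f₂ : X ⟶ Y) (hf : factorRel M P f₁ f₂) : factorRel M P (r • f₁) (r • f₂) := by
  obtain ⟨K, a, b, hK, h⟩ := hf
  refine ⟨K, a, r • b, hK, ?_⟩
  rw [Linear.comp_smul, h, smul_sub]
  rfl

/-- Closure of a class of objects under binary biproducts and zero objects; it ensures that the
morphisms factoring through such objects form an ideal. -/
class IsAdditiveClass [HasBinaryBiproducts A] (P : ObjectProperty A) :
    Prop where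
  zero : P.ContainsZero
  biprod : ∀ X Y : A, P X → P Y → P (X ⊞ Y)

variable [HasBinaryBiproducts A]

instance [HasZeroObject A] : IsAdditiveClass (isProjective A) where
  zero := ⟨0, isZero_zero A, (inferInstance : Projective (0 : A))⟩
  biprod X Y hX hY := by
    have : Projective X := hX
    have : Projective Y := hY
    exact (inferInstance : Projective (X ⊞ Y))

instance [HasZeroObject A] : IsAdditiveClass (isInjective A) where
  zero := ⟨0, isZero_zero A, (inferInstance : Injective (0 : A))⟩
  biprod X Y hX hY := by
    have : Injective X := hX
    have : Injective Y := hY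
    exact (inferInstance : Injective (X ⊞ Y))

variable (M P : ObjectProperty A) [IsAdditiveClass P]

theorem factorRel_add {X Y : M.FullSubcategory} (f₁ f₂ g₁ g₂ : X ⟶ Y)
    (hf : factorRel M P f₁ f₂) (hg : factorRel M P g₁ g₂) :
    factorRel M P (f₁ + g₁) (f₂ + g₂) := by
  obtain ⟨K, a, b, hK, h⟩ := hf
  obtain ⟨L, c, d, hL, k⟩ := hg
  refine ⟨K ⊞ L, biprod.lift a c, biprod.desc b d, IsAdditiveClass.biprod K L hK hL, ?_⟩
  have e₁ : (f₁ + g₁).hom = f₁.hom + g₁.hom := rfl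
  have e₂ : (f₂ + g₂).hom = f₂.hom + g₂.hom := rfl
  rw [biprod.lift_desc, h, k, e₁, e₂]
  abel

instance : Congruence (factorRel M P) where
  comp_left := by
    rintro X Y Z f g g' ⟨K, a, b, hK, h⟩
    refine ⟨K, f.hom ≫ a, b, hK, ?_⟩
    rw [Category.assoc, h, Preadditive.comp_sub]
    rfl
  comp_right := by
    rintro X Y Z f f' g ⟨K, a, b, hK, h⟩
    refine ⟨K, a, b ≫ g.hom, hK, ?_⟩
    rw [← Category.assoc, h, Preadditive.sub_comp]
    rfl
  equivalence {X Y} :=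
    { refl := fun f => by
        obtain ⟨Z, -, hZ⟩ := (IsAdditiveClass.zero (P := P)).exists_zero
        exact ⟨Z, 0, 0, hZ, by simp⟩
      symm := by
        rintro f g ⟨K, a, b, hK, h⟩
        exact ⟨K, a, -b, hK, by simp [h]⟩
      trans := by
        rintro f g k ⟨K, a, b, hK, h⟩ ⟨L, c, d, hL, l⟩
        refine ⟨K ⊞ L, biprod.lift a c, biprod.desc b d,
          IsAdditiveClass.biprod K L hK hL, ?_⟩
        rw [biprod.lift_desc, h, l]
        abel }

instance : Preadditive (Quotient (factorRel M P)) :=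
  Quotient.preadditive _ (fun _ _ f₁ f₂ g₁ g₂ => factorRel_add M P f₁ f₂ g₁ g₂)

instance : (Quotient.functor (factorRel M P)).Additive :=
  Quotient.functor_additive _ (fun _ _ f₁ f₂ g₁ g₂ => factorRel_add M P f₁ f₂ g₁ g₂)

instance {R : Type*} [Ring R] [Linear R A] : Linear R (Quotient (factorRel M P)) :=
  Quotient.linear R _ (fun r _ _ f₁ f₂ => factorRel_smul M P r f₁ f₂)

/-- The stable category `M̲`: morphisms of `M` modulo those factoring through a projective
object. -/
abbrev ProjStable [HasZeroObject A] (M : ObjectProperty A) := Quotient (factorRel M (isProjective A))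

/-- The stable category `M̄`: morphisms of `M` modulo those factoring through an injective
object. -/
abbrev InjStable [HasZeroObject A] (M : ObjectProperty A) := Quotient (factorRel M (isInjective A))

/-- The canonical functor `M ⥤ M̲`. -/
abbrev toProjStable [HasZeroObject A] (M : ObjectProperty A) : M.FullSubcategory ⥤ ProjStable M :=
  Quotient.functor _

/-- The canonical functor `M ⥤ M̄`. -/
abbrev toInjStable [HasZeroObject A] (M : ObjectProperty A) : M.FullSubcategory ⥤ InjStable M :=
  Quotient.functor _

end StableCategory

/-! ### Finitely generated modules over an artin algebra -/

section ArtinAlgebra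

/-- `Λ` is an artin `R`-algebra: `R` is a commutative artinian ring and the `R`-algebra `Λ` is
finitely generated as an `R`-module. -/
class IsArtinAlgebra (R Λ : Type u) [CommRing R] [Ring Λ] [Algebra R Λ] : Prop where
  isArtinianRing : IsArtinianRing R
  finite : Module.Finite R Λ

theorem IsArtinAlgebra.isNoetherianRing (R Λ : Type u) [CommRing R] [Ring Λ] [Algebra R Λ]
    [h : IsArtinAlgebra R Λ] : IsNoetherianRing Λ :=
  have := h.isArtinianRing
  have := h.finite
  IsNoetherianRing.of_finite R Λ

/-- The category `mod Λ` of finitely generated modules over the artin `R`-algebra `Λ`. -/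
@[nolint unusedArguments]
def FinMod (R Λ : Type u) [CommRing R] [Ring Λ] [Algebra R Λ] [IsArtinAlgebra R Λ] :
    Type (u + 1) :=
  FGModuleCat.{u} Λ

variable (R Λ : Type u) [CommRing R] [Ring Λ] [Algebra R Λ] [IsArtinAlgebra R Λ]

instance : Category.{u} (FinMod R Λ) := inferInstanceAs (Category (FGModuleCat.{u} Λ))

instance : Abelian (FinMod R Λ) :=
  have := IsArtinAlgebra.isNoetherianRing R Λ
  inferInstanceAs (Abelian (FGModuleCat.{u} Λ))

open scoped ModuleCat.Algebra in
/-- The `R`-linear structure on `mod Λ`: `(r • f) x = r • f x`, where `R` acts on a `Λ`-module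
through the structure map `R → Λ`. -/
instance : Linear R (FinMod R Λ) :=
  inferInstanceAs (Linear R (FGModuleCat.{u} Λ))

instance : HasExt.{u + 1} (FinMod R Λ) := HasExt.standard (FinMod R Λ)

end ArtinAlgebra

/-! ### Injective envelopes -/

/-- `ι : N → E` is an injective envelope of the `R`-module `N`: `E` is an injective `R`-module,
`ι` is injective, and every nonzero submodule of `E` meets the image of `ι` nontrivially. -/
structure IsInjectiveEnvelope {R N E : Type u} [CommRing R] [AddCommGroup N] [Module R N]
    [AddCommGroup E] [Module R E] (ι : N →ₗ[R] E) : Prop where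
  injective_module : Module.Injective R E
  injective : Function.Injective ι
  essential : ∀ S : Submodule R E, S ⊓ LinearMap.range ι = ⊥ → S = ⊥

end NAR

end

/-! Write D = Hom_R(-, E). The argument runs on pairings. A functional `t` on Ext^j(X, V) pairs
Ext^j(X, Y) with Hom(Y, V) and Ext^j(Y, V) with Hom(X, Y). `IsARPair` asks that these identify D
Ext^j(X, Y) with Hom(Y, V) modulo injectives and D Ext^j(Y, V) with Hom(X, Y) modulo projectives.
Then V serves as a translate of X and X as an inverse translate of V.

The starting point is a perfect pairing on Hom: the trace on Hom(Λ^k, (DΛ)^k), where Matlis duality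
over R gives perfectness (`isNakayamaPair_trace`). Given a projective presentation P₁ → P₀ → X,
Nakayama duality produces I₁ → I₀. A diagram chase shows that its kernel V pairs with X in degree 1
(`isARPair_one`); this is the classical Auslander–Reiten formula.

To raise the degree, X is kept and V is replaced by the kernel of a right approximation I → V by an
injective (`IsARPair.shift_right`). Cluster tilting enters here: for Y in M and 0 < j < n, Ext^j(X,
Y) = 0, so every Y → V factors through an injective and hence through I. For Y projective this makes
I → V epi; for general Y it kills Ext¹ from Y to the kernel. In degree n, V therefore satisfies the
vanishing that characterizes M. The dual construction starts from V in M and ends with X in M.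

Now V represents Y ↦ D Ext^n(X, Y) on the stable category modulo injectives, so Yoneda makes X ↦ V a
functor. The pairing of Ext^n(Y, V) with Hom(X, Y) makes it full and faithful on the stable category
modulo projectives, and the dual construction makes it dense. Dualizing once more gives the formula,
because Ext^n is finitely generated over R and hence reflexive. -/

noncomputable section

namespace NAR

/-! ### Extending and descending functionals -/

section

universe w w₁ w₂ w₃

/-- Functionals with values in an injective module extend along any linear map whose kernel they
annihilate. -/
theorem exists_comp_eq_of_ker_le {R : Type w} [CommRing R] {E : Type w₁} [AddCommGroup E]
    [Module R E] (hE : Module.Baer R E) {N : Type w₂} {N' : Type w₃} [AddCommGroup N] [Module R N]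
    [AddCommGroup N'] [Module R N'] (f : N →ₗ[R] N') (χ : N →ₗ[R] E)
    (h : ∀ x, f x = 0 → χ x = 0) : ∃ ψ : N' →ₗ[R] E, ∀ x, ψ (f x) = χ x := by
  let χ' : (N ⧸ LinearMap.ker f) →ₗ[R] E := (LinearMap.ker f).liftQ χ fun x hx => h x hx
  let f' : (N ⧸ LinearMap.ker f) →ₗ[R] N' := (LinearMap.ker f).liftQ f le_rfl
  have hf' : Function.Injective f' := by
    rw [← LinearMap.ker_eq_bot]
    exact Submodule.ker_liftQ_eq_bot _ _ _ le_rfl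
  obtain ⟨ψ, hψ⟩ := hE.extension_property f' hf' χ'
  exact ⟨ψ, fun x => LinearMap.congr_fun hψ ((LinearMap.ker f).mkQ x)⟩

/-- A functional which annihilates the kernel of a surjective linear map descends along it. -/
theorem exists_comp_eq_of_surjective {R : Type w} [CommRing R] {E : Type w₁} [AddCommGroup E]
    [Module R E] {N : Type w₂} {N' : Type w₃} [AddCommGroup N] [Module R N]
    [AddCommGroup N'] [Module R N'] (f : N →ₗ[R] N') (hf : Function.Surjective f) (χ : N →ₗ[R] E)
    (h : ∀ x, f x = 0 → χ x = 0) : ∃ ψ : N' →ₗ[R] E, ∀ x, ψ (f x) = χ x :=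
  ⟨((LinearMap.ker f).liftQ χ fun x hx => h x hx) ∘ₗ
      (f.quotKerEquivOfSurjective hf).symm.toLinearMap, fun x => by
    have : (f.quotKerEquivOfSurjective hf).symm (f x) = (LinearMap.ker f).mkQ x := by
      rw [LinearEquiv.symm_apply_eq]; rfl
    rw [LinearMap.comp_apply, LinearEquiv.coe_coe, this]; rfl⟩

end

/-! ### Nakayama pairs and Auslander–Reiten pairs -/

section Pairs

universe w w' w''

variable {A : Type u} [Category.{v} A] [Abelian A] {R : Type w'} [CommRing R] [Linear R A]
  {E : Type w''} [AddCommGroup E] [Module R E]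

/-- A functional `t` on `Hom(P, I)`, with `P` projective and `I` injective, such that the pairings
`Hom(P, Y) × Hom(Y, I) → E` induced by `t` identify `Hom(Y, I)` with the dual of `Hom(P, Y)` and
`Hom(P, Y)` with the dual of `Hom(Y, I)`. -/
structure IsNakayamaPair {P I : A} (t : (P ⟶ I) →ₗ[R] E) : Prop where
  projective : Projective P
  injective : Injective I
  surj_left (Y : A) (φ : (P ⟶ Y) →ₗ[R] E) : ∃ h : Y ⟶ I, ∀ a, t (a ≫ h) = φ a
  inj_left (Y : A) (h : Y ⟶ I) : (∀ a : P ⟶ Y, t (a ≫ h) = 0) → h = 0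
  surj_right (X : A) (φ : (X ⟶ I) →ₗ[R] E) : ∃ f : P ⟶ X, ∀ a, t (f ≫ a) = φ a
  inj_right (X : A) (f : P ⟶ X) : (∀ a : X ⟶ I, t (f ≫ a) = 0) → f = 0

variable (A R E) in
/-- Every object is a quotient of the projective part of a Nakayama pair, and a subobject of the
injective part of a Nakayama pair. -/
structure HasEnoughNakayamaPairs : Prop where
  exists_epi (X : A) : ∃ (P I : A) (t : (P ⟶ I) →ₗ[R] E) (p : P ⟶ X), IsNakayamaPair t ∧ Epi p
  exists_mono (X : A) : ∃ (P I : A) (t : (P ⟶ I) →ₗ[R] E) (i : X ⟶ I), IsNakayamaPair t ∧ Mono i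

/-- The morphism `ν` corresponding to `d` under Nakayama duality. -/
theorem IsNakayamaPair.exists_map {P₁ I₁ P₀ I₀ : A} {t₁ : (P₁ ⟶ I₁) →ₗ[R] E}
    {t₀ : (P₀ ⟶ I₀) →ₗ[R] E} (h₀ : IsNakayamaPair t₀) (d : P₁ ⟶ P₀) :
    ∃ ν : I₁ ⟶ I₀, ∀ a : P₀ ⟶ I₁, t₁ (d ≫ a) = t₀ (a ≫ ν) := by
  obtain ⟨ν, hν⟩ := h₀.surj_left I₁ (t₁ ∘ₗ Linear.leftComp R I₁ d)
  exact ⟨ν, fun a => (hν a).symm⟩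

theorem IsNakayamaPair.exists_comap {P₁ I₁ P₀ I₀ : A} {t₁ : (P₁ ⟶ I₁) →ₗ[R] E}
    {t₀ : (P₀ ⟶ I₀) →ₗ[R] E} (h₁ : IsNakayamaPair t₁) (ν : I₁ ⟶ I₀) :
    ∃ d : P₁ ⟶ P₀, ∀ a : P₀ ⟶ I₁, t₁ (d ≫ a) = t₀ (a ≫ ν) := by
  obtain ⟨d, hd⟩ := h₁.surj_right P₀ (t₀ ∘ₗ Linear.rightComp R P₀ ν)
  exact ⟨d, fun a => hd a⟩

variable [HasExt.{w} A]

/-- A functional `t` on `Ext^j(X, V)` such that the induced pairings identify, for all `Y`,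
the dual of `Ext^j(X, Y)` with `Hom(Y, V)` modulo morphisms factoring through injectives, and the
dual of `Ext^j(Y, V)` with `Hom(X, Y)` modulo morphisms factoring through projectives. -/
structure IsARPair {j : ℕ} {X V : A} (t : Ext.{w} X V j →ₗ[R] E) : Prop where
  surj_left (Y : A) (φ : Ext.{w} X Y j →ₗ[R] E) :
    ∃ h : Y ⟶ V, ∀ e, t (e.comp (Ext.mk₀ h) (add_zero j)) = φ e
  inj_left (Y : A) (h : Y ⟶ V) :
    (∀ e : Ext.{w} X Y j, t (e.comp (Ext.mk₀ h) (add_zero j)) = 0) →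
      ∃ (K : A) (a : Y ⟶ K) (b : K ⟶ V), Injective K ∧ a ≫ b = h
  surj_right (Y : A) (φ : Ext.{w} Y V j →ₗ[R] E) :
    ∃ f : X ⟶ Y, ∀ e, t ((Ext.mk₀ f).comp e (zero_add j)) = φ e
  inj_right (Y : A) (f : X ⟶ Y) :
    (∀ e : Ext.{w} Y V j, t ((Ext.mk₀ f).comp e (zero_add j)) = 0) →
      ∃ (K : A) (a : X ⟶ K) (b : K ⟶ Y), Projective K ∧ a ≫ b = f

theorem ext_eq_zero_of_projective {P Y : A} (hP : Projective P) {n : ℕ} (hn : 0 < n)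
    (e : Ext.{w} P Y n) : e = 0 := by
  obtain ⟨n, rfl⟩ := Nat.exists_eq_succ_of_ne_zero hn.ne'
  exact Ext.eq_zero_of_projective e

theorem ext_eq_zero_of_injective {X I : A} (hI : Injective I) {n : ℕ} (hn : 0 < n)
    (e : Ext.{w} X I n) : e = 0 := by
  obtain ⟨n, rfl⟩ := Nat.exists_eq_succ_of_ne_zero hn.ne'
  exact Ext.eq_zero_of_injective e

theorem ext_comp_eq_zero_of_injective {X Y K V : A} (hK : Injective K) {j : ℕ} (hj : 0 < j)
    (a : Y ⟶ K) (b : K ⟶ V) (e : Ext.{w} X Y j) :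
    e.comp (Ext.mk₀ (a ≫ b)) (add_zero j) = 0 := by
  rw [← Ext.mk₀_comp_mk₀, ← Ext.comp_assoc_of_third_deg_zero,
    ext_eq_zero_of_injective hK hj (e.comp (Ext.mk₀ a) (add_zero j)), Ext.zero_comp]

theorem comp_ext_eq_zero_of_projective {X Y K V : A} (hK : Projective K) {j : ℕ} (hj : 0 < j)
    (a : X ⟶ K) (b : K ⟶ Y) (e : Ext.{w} Y V j) :
    (Ext.mk₀ (a ≫ b)).comp e (zero_add j) = 0 := by
  rw [← Ext.mk₀_comp_mk₀_assoc,
    ext_eq_zero_of_projective hK hj ((Ext.mk₀ b).comp e (zero_add j)), Ext.comp_zero]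

/-- `a ↦ a ∘ [S]` is surjective onto `Ext¹(X, Y)` if the middle term of `S` is projective. -/
theorem exists_extClass_comp_eq {S : ShortComplex A} (hS : S.ShortExact) (hP : Projective S.X₂)
    {Y : A} (e : Ext.{w} S.X₃ Y 1) :
    ∃ a : S.X₁ ⟶ Y, hS.extClass.comp (Ext.mk₀ a) (add_zero 1) = e := by
  obtain ⟨x, hx⟩ := Ext.contravariant_sequence_exact₃ hS Y e
    (ext_eq_zero_of_projective hP one_pos _) (add_zero 1)
  obtain ⟨a, rfl⟩ := (Ext.mk₀_bijective _ _).surjective x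
  exact ⟨a, hx⟩

theorem exists_comp_extClass_eq {S : ShortComplex A} (hS : S.ShortExact) (hI : Injective S.X₂)
    {X : A} (e : Ext.{w} X S.X₁ 1) :
    ∃ b : X ⟶ S.X₃, (Ext.mk₀ b).comp hS.extClass (zero_add 1) = e := by
  obtain ⟨x, hx⟩ := Ext.covariant_sequence_exact₁ X hS e
    (ext_eq_zero_of_injective hI one_pos _) (zero_add 1)
  obtain ⟨a, rfl⟩ := (Ext.mk₀_bijective _ _).surjective x
  exact ⟨a, hx⟩

theorem exists_eq_comp_of_extClass_comp_eq_zero {S : ShortComplex A} (hS : S.ShortExact)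
    {Y : A} (a : S.X₁ ⟶ Y) (ha : (hS.extClass : Ext.{w} _ _ 1).comp (Ext.mk₀ a) (add_zero 1) = 0) :
    ∃ b : S.X₂ ⟶ Y, S.f ≫ b = a := by
  obtain ⟨x, hx⟩ := Ext.contravariant_sequence_exact₁ hS Y (Ext.mk₀ a) (add_zero 1) ha
  obtain ⟨b, rfl⟩ := (Ext.mk₀_bijective _ _).surjective x
  exact ⟨b, (Ext.mk₀_bijective _ _).injective (by rw [← Ext.mk₀_comp_mk₀, hx])⟩

/-! ### From Nakayama pairs to pairs for `Ext¹` -/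

section LevelOne

variable {P₁ I₁ P₀ I₀ : A} {t₁ : (P₁ ⟶ I₁) →ₗ[R] E} {t₀ : (P₀ ⟶ I₀) →ₗ[R] E}
  {Ω X V B : A} {q : P₁ ⟶ Ω} {s : Ω ⟶ P₀} {π : P₀ ⟶ X} {ι : V ⟶ I₁} {p : I₁ ⟶ B} {m : B ⟶ I₀}
  {wX : s ≫ π = 0} {wV : ι ≫ p = 0}

/-- The first formula defines `t`, since every class in Ext¹(X, V) is a pushout of the class of Ω →
P₀ → X. The second formula, by pullbacks of V → I₁ → B, is what makes the construction symmetric in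
X and V. -/
theorem exists_functional_ext_one (h₀ : IsNakayamaPair t₀)
    (hS : (ShortComplex.mk s π wX).ShortExact) (hT : (ShortComplex.mk ι p wV).ShortExact)
    (hν : ∀ a : P₀ ⟶ I₁, t₁ (q ≫ s ≫ a) = t₀ (a ≫ p ≫ m)) :
    ∃ t : Ext.{w} X V 1 →ₗ[R] E,
      (∀ a : Ω ⟶ V, t (hS.extClass.comp (Ext.mk₀ a) (add_zero 1)) = t₁ (q ≫ a ≫ ι)) ∧
      ∀ b : X ⟶ B, t ((Ext.mk₀ b).comp hT.extClass (zero_add 1)) = t₀ (π ≫ b ≫ m) := by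
  have := h₀.projective
  let θ : (Ω ⟶ V) →ₗ[R] Ext.{w} X V 1 :=
    { toFun := fun a => hS.extClass.comp (Ext.mk₀ a) (add_zero 1)
      map_add' := fun a b => by rw [Ext.mk₀_add, Ext.comp_add]
      map_smul' := fun r a => by rw [Ext.mk₀_smul, Ext.comp_smul, RingHom.id_apply] }
  obtain ⟨t, ht⟩ := exists_comp_eq_of_surjective θ
    (fun e => exists_extClass_comp_eq hS h₀.projective e)
    (t₁ ∘ₗ Linear.leftComp R I₁ q ∘ₗ Linear.rightComp R Ω ι) (by
      intro a ha
      -- Well-definedness: if `a` extends to `b` on P₀, then `hν` turns the value into `t₀` of a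
      -- composite containing ι ≫ p = 0.
      obtain ⟨b, hb⟩ := exists_eq_comp_of_extClass_comp_eq_zero hS a ha
      dsimp at b hb ⊢
      rw [← hb, Linear.rightComp_apply, Linear.leftComp_apply, Category.assoc, hν, Category.assoc,
        reassoc_of% wV, zero_comp, comp_zero, map_zero])
  refine ⟨t, ht, fun b => ?_⟩
  have := hT.epi_g
  have := hT.mono_f
  dsimp at *
  -- Lifting `b` to a morphism of the two short exact sequences rewrites the pullback class as a
  -- pushout class.
  let l : P₀ ⟶ I₁ := Projective.factorThru (π ≫ b) p
  have hl : l ≫ p = π ≫ b := Projective.factorThru_comp _ _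
  obtain ⟨a, ha⟩ : ∃ a : Ω ⟶ V, a ≫ ι = s ≫ l :=
    ⟨hT.exact.lift (s ≫ l) (by simp [hl, reassoc_of% wX]), hT.exact.lift_f _ _⟩
  have hc := ShortComplex.ShortExact.extClass_naturality.{w} hS hT
    { τ₁ := a, τ₂ := l, τ₃ := b, comm₁₂ := ha, comm₂₃ := hl }
  rw [← hc]
  refine (ht a).trans ?_
  rw [Linear.rightComp_apply, Linear.leftComp_apply, ha, hν, reassoc_of% hl]

/-- Any morphism which is annihilated by the functional `t` on `Ext¹(X, V)` factors through a
fixed morphism from an injective. -/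
theorem exists_injective_of_functional (hE : Module.Baer R E) (hA : HasEnoughNakayamaPairs A R E)
    (h₁ : IsNakayamaPair t₁) (h₀ : IsNakayamaPair t₀)
    (hS : (ShortComplex.mk s π wX).ShortExact) (hT : (ShortComplex.mk ι p wV).ShortExact)
    [Epi q] [Mono m] (hν : ∀ a : P₀ ⟶ I₁, t₁ (q ≫ s ≫ a) = t₀ (a ≫ p ≫ m))
    (t : Ext.{w} X V 1 →ₗ[R] E)
    (ht : ∀ a : Ω ⟶ V, t (hS.extClass.comp (Ext.mk₀ a) (add_zero 1)) = t₁ (q ≫ a ≫ ι)) :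
    ∃ (K : A) (b : K ⟶ V), Injective K ∧ ∀ (Y : A) (h : Y ⟶ V),
      (∀ e : Ext.{w} X Y 1, t (e.comp (Ext.mk₀ h) (add_zero 1)) = 0) → ∃ a : Y ⟶ K, a ≫ b = h := by
  -- The presentation is continued by P₂ → P₁, exact at P₁. The dual morphism I₂ → I₁ lands in V,
  -- and I₂ → V is the required morphism, independent of Y.
  obtain ⟨P₂, I₂, t₂, r₀, h₂, _⟩ := hA.exists_epi (kernel q)
  obtain ⟨ν₂, hν₂⟩ := h₁.exists_map (t₁ := t₂) (r₀ ≫ kernel.ι q)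
  have := hT.mono_f
  dsimp at this
  have hν₂p : ν₂ ≫ p = 0 := by
    rw [← cancel_mono m, zero_comp]
    refine h₀.inj_left _ _ fun a => ?_
    have e := hν (a ≫ ν₂)
    rw [Category.assoc] at e
    rw [Category.assoc, ← e, ← Category.assoc s, ← Category.assoc q, ← hν₂]
    simp
  refine ⟨I₂, hT.exact.lift ν₂ hν₂p, h₂.injective, fun Y h hh => ?_⟩
  -- A morphism P₁ → Y that vanishes on P₂ comes from Ω, where the hypothesis on `h` applies. So the
  -- functional defined by `h` on Hom(P₁, Y) comes from Hom(P₂, Y), where it is represented by a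
  -- morphism to I₂.
  obtain ⟨ψ, hψ⟩ := exists_comp_eq_of_ker_le hE (Linear.leftComp R Y (r₀ ≫ kernel.ι q))
    (t₁ ∘ₗ Linear.rightComp R P₁ (h ≫ ι)) (by
      intro c hc
      have hc' : kernel.ι q ≫ c = 0 := by
        rw [← cancel_epi r₀]
        simpa using hc
      obtain ⟨a, rfl⟩ : ∃ a, q ≫ a = c := ⟨Abelian.epiDesc q c hc', Abelian.comp_epiDesc _ _ _⟩
      have e := ht (a ≫ h)
      rw [← Ext.mk₀_comp_mk₀, ← Ext.comp_assoc_of_third_deg_zero, hh] at e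
      simpa using e.symm)
  obtain ⟨g, hg⟩ := h₂.surj_left Y ψ
  refine ⟨g, ?_⟩
  rw [← cancel_mono ι, Category.assoc, hT.exact.lift_f]
  refine sub_eq_zero.1 (h₁.inj_left Y _ fun c => ?_)
  have e := hψ c
  rw [← hg] at e
  simp only [Linear.leftComp_apply, LinearMap.comp_apply, Linear.rightComp_apply] at e
  rw [Preadditive.comp_sub, map_sub, ← e, sub_eq_zero, ← Category.assoc c, ← hν₂]
  simp

/-- Dual to `exists_injective_of_functional`: the copresentation is continued by I₀ → I₂, and the
dual P₀ → P₂ factors through X. -/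
theorem exists_projective_of_functional (hE : Module.Baer R E) (hA : HasEnoughNakayamaPairs A R E)
    (h₁ : IsNakayamaPair t₁) (h₀ : IsNakayamaPair t₀)
    (hS : (ShortComplex.mk s π wX).ShortExact) (hT : (ShortComplex.mk ι p wV).ShortExact)
    [Epi q] [Mono m] (hν : ∀ a : P₀ ⟶ I₁, t₁ (q ≫ s ≫ a) = t₀ (a ≫ p ≫ m))
    (t : Ext.{w} X V 1 →ₗ[R] E)
    (ht : ∀ b : X ⟶ B, t ((Ext.mk₀ b).comp hT.extClass (zero_add 1)) = t₀ (π ≫ b ≫ m)) :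
    ∃ (K : A) (a : X ⟶ K), Projective K ∧ ∀ (Y : A) (f : X ⟶ Y),
      (∀ e : Ext.{w} Y V 1, t ((Ext.mk₀ f).comp e (zero_add 1)) = 0) → ∃ b : K ⟶ Y, a ≫ b = f := by
  obtain ⟨P₂, I₂, t₂, r₀, h₂, _⟩ := hA.exists_mono (cokernel m)
  obtain ⟨d₂, hd₂⟩ := h₀.exists_comap (t₀ := t₂) (cokernel.π m ≫ r₀)
  have := hS.epi_g
  dsimp at this
  have hd₂s : s ≫ d₂ = 0 := by
    rw [← cancel_epi q, comp_zero]
    refine h₁.inj_right _ _ fun a => ?_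
    rw [Category.assoc, Category.assoc, hν (d₂ ≫ a), Category.assoc, hd₂]
    simp
  refine ⟨P₂, hS.exact.desc d₂ hd₂s, h₂.projective, fun Y f hf => ?_⟩
  obtain ⟨ψ, hψ⟩ := exists_comp_eq_of_ker_le hE (Linear.rightComp R Y (cokernel.π m ≫ r₀))
    (t₀ ∘ₗ Linear.leftComp R I₀ (π ≫ f)) (by
      intro c hc
      have hc' : c ≫ cokernel.π m = 0 := by
        rw [← cancel_mono r₀]
        simpa using hc
      obtain ⟨b, rfl⟩ : ∃ b, b ≫ m = c := ⟨Abelian.monoLift m c hc', Abelian.monoLift_comp _ _ _⟩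
      have e := ht (f ≫ b)
      rw [← Ext.mk₀_comp_mk₀_assoc, hf] at e
      simpa using e.symm)
  obtain ⟨g, hg⟩ := h₂.surj_right Y ψ
  refine ⟨g, ?_⟩
  rw [← cancel_epi π, ← Category.assoc]
  erw [hS.exact.g_desc]
  refine sub_eq_zero.1 (h₀.inj_right Y _ fun c => ?_)
  have e := hψ c
  rw [← hg] at e
  simp only [Linear.leftComp_apply, LinearMap.comp_apply, Linear.rightComp_apply] at e
  rw [Preadditive.sub_comp, map_sub, ← e, sub_eq_zero, Category.assoc, hd₂]
  simp

theorem isARPair_one (hE : Module.Baer R E) (hA : HasEnoughNakayamaPairs A R E)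
    (h₁ : IsNakayamaPair t₁) (h₀ : IsNakayamaPair t₀)
    (hS : (ShortComplex.mk s π wX).ShortExact) (hT : (ShortComplex.mk ι p wV).ShortExact)
    [Epi q] [Mono m] (hν : ∀ a : P₀ ⟶ I₁, t₁ (q ≫ s ≫ a) = t₀ (a ≫ p ≫ m))
    (t : Ext.{w} X V 1 →ₗ[R] E)
    (ht : ∀ a : Ω ⟶ V, t (hS.extClass.comp (Ext.mk₀ a) (add_zero 1)) = t₁ (q ≫ a ≫ ι))
    (ht' : ∀ b : X ⟶ B, t ((Ext.mk₀ b).comp hT.extClass (zero_add 1)) = t₀ (π ≫ b ≫ m)) :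
    IsARPair t where
  surj_left Y φ := by
    let θ : (Ω ⟶ Y) →ₗ[R] Ext.{w} X Y 1 :=
      { toFun := fun a => hS.extClass.comp (Ext.mk₀ a) (add_zero 1)
        map_add' := fun a b => by rw [Ext.mk₀_add, Ext.comp_add]
        map_smul' := fun r a => by rw [Ext.mk₀_smul, Ext.comp_smul, RingHom.id_apply] }
    have hθ (c : P₀ ⟶ Y) : θ (s ≫ c) = 0 := by
      change hS.extClass.comp (Ext.mk₀ _) (add_zero 1) = 0
      rw [← Ext.mk₀_comp_mk₀]
      exact ShortComplex.ShortExact.extClass_comp_assoc hS (Ext.mk₀ c)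
    -- Hom(Ω, Y) embeds in Hom(P₁, Y), so the functional extends and is represented by some `g : Y ⟶
    -- I₁`. It lands in V because `φ ∘ₗ θ` kills morphisms that extend to P₀.
    obtain ⟨ψ, hψ⟩ := exists_comp_eq_of_ker_le hE (Linear.leftComp R Y q) (φ ∘ₗ θ) (by
      intro a ha
      have : a = 0 := by rw [← cancel_epi q]; simpa using ha
      simp [this])
    obtain ⟨g, hg⟩ := h₁.surj_left Y ψ
    have := hT.mono_f
    dsimp at this
    have hgp : g ≫ p = 0 := by
      rw [← cancel_mono m, zero_comp]
      refine h₀.inj_left _ _ fun c => ?_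
      have e := hν (c ≫ g)
      rw [Category.assoc] at e
      rw [Category.assoc, ← e, ← Category.assoc s, ← Category.assoc q, hg]
      exact (hψ (s ≫ c)).trans (by simp [hθ])
    refine ⟨hT.exact.lift g hgp, fun e => ?_⟩
    obtain ⟨a, rfl⟩ := exists_extClass_comp_eq hS h₀.projective e
    rw [Ext.comp_assoc_of_third_deg_zero, Ext.mk₀_comp_mk₀]
    refine (ht _).trans ?_
    rw [Category.assoc]
    erw [hT.exact.lift_f]
    rw [← Category.assoc, hg]
    exact hψ a
  inj_left Y h hh := by
    obtain ⟨K, b, hK, hb⟩ := exists_injective_of_functional hE hA h₁ h₀ hS hT hν t ht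
    obtain ⟨a, ha⟩ := hb Y h hh
    exact ⟨K, a, b, hK, ha⟩
  surj_right Y φ := by
    let θ : (Y ⟶ B) →ₗ[R] Ext.{w} Y V 1 :=
      { toFun := fun b => (Ext.mk₀ b).comp hT.extClass (zero_add 1)
        map_add' := fun a b => by rw [Ext.mk₀_add, Ext.add_comp]
        map_smul' := fun r a => by rw [Ext.mk₀_smul, Ext.smul_comp, RingHom.id_apply] }
    have hθ (c : Y ⟶ I₁) : θ (c ≫ p) = 0 := by
      change (Ext.mk₀ _).comp hT.extClass (zero_add 1) = 0
      rw [← Ext.mk₀_comp_mk₀_assoc]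
      erw [hT.comp_extClass]
      rw [Ext.comp_zero]
    obtain ⟨ψ, hψ⟩ := exists_comp_eq_of_ker_le hE (Linear.rightComp R Y m) (φ ∘ₗ θ) (by
      intro a ha
      have : a = 0 := by rw [← cancel_mono m]; simpa using ha
      simp [this])
    obtain ⟨g, hg⟩ := h₀.surj_right Y ψ
    have := hS.epi_g
    dsimp at this
    have hgs : s ≫ g = 0 := by
      rw [← cancel_epi q, comp_zero]
      refine h₁.inj_right _ _ fun c => ?_
      rw [Category.assoc, Category.assoc, hν (g ≫ c), Category.assoc, hg, ← Category.assoc]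
      exact (hψ (c ≫ p)).trans (by simp [hθ])
    refine ⟨hS.exact.desc g hgs, fun e => ?_⟩
    obtain ⟨b, rfl⟩ := exists_comp_extClass_eq hT h₁.injective e
    rw [Ext.mk₀_comp_mk₀_assoc]
    refine (ht' _).trans ?_
    rw [Category.assoc, ← Category.assoc π]
    erw [hS.exact.g_desc]
    rw [hg]
    exact hψ b
  inj_right Y f hf := by
    obtain ⟨K, a, hK, ha⟩ := exists_projective_of_functional hE hA h₁ h₀ hS hT hν t ht'
    obtain ⟨b, hb⟩ := ha Y f hf
    exact ⟨K, a, b, hK, hb⟩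

end LevelOne

end Pairs

/-! ### Degree one and dimension shift -/

section Steps

universe w w' w''

variable {A : Type u} [Category.{v} A] [Abelian A] {R : Type w'} [CommRing R] [Linear R A]
  {E : Type w''} [AddCommGroup E] [Module R E]

theorem shortExact_kernel {X Y : A} (f : X ⟶ Y) [Epi f] :
    (ShortComplex.mk (kernel.ι f) f (kernel.condition f)).ShortExact where
  exact := ShortComplex.exact_kernel f

theorem shortExact_cokernel {X Y : A} (f : X ⟶ Y) [Mono f] :
    (ShortComplex.mk f (cokernel.π f) (cokernel.condition f)).ShortExact where
  exact := ShortComplex.exact_cokernel f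

variable [HasExt.{w} A]

/-- V is the kernel of the Nakayama dual of a projective presentation of X. The final clause, with
one projective serving all Y, yields the left approximation of X by a projective. -/
theorem exists_isARPair_one_left (hE : Module.Baer R E) (hA : HasEnoughNakayamaPairs A R E)
    (X : A) :
    ∃ (V : A) (t : Ext.{w} X V 1 →ₗ[R] E), IsARPair t ∧
      ∃ (K : A) (a : X ⟶ K), Projective K ∧ ∀ (Y : A) (f : X ⟶ Y),
        (∀ e : Ext.{w} Y V 1, t ((Ext.mk₀ f).comp e (zero_add 1)) = 0) →
          ∃ b : K ⟶ Y, a ≫ b = f := by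
  obtain ⟨P₀, I₀, t₀, π, h₀, _⟩ := hA.exists_epi X
  obtain ⟨P₁, I₁, t₁, q, h₁, _⟩ := hA.exists_epi (kernel π)
  obtain ⟨ν, hν⟩ := h₀.exists_map (t₁ := t₁) (q ≫ kernel.ι π)
  have hν' : ∀ a : P₀ ⟶ I₁, t₁ (q ≫ kernel.ι π ≫ a) =
      t₀ (a ≫ Abelian.factorThruImage ν ≫ Abelian.image.ι ν) := fun a => by
    rw [Abelian.image.fac, ← hν, Category.assoc]
  have hT : (ShortComplex.mk (kernel.ι ν) (Abelian.factorThruImage ν)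
      (by rw [← cancel_mono (Abelian.image.ι ν)]; simp)).ShortExact :=
    { exact := by
        refine ShortComplex.exact_of_f_is_kernel _ ?_
        exact isKernelOfComp _ _ (kernelIsKernel ν) _ (Abelian.image.fac ν) }
  obtain ⟨t, ht, ht'⟩ := exists_functional_ext_one.{u, v, w} h₀ (shortExact_kernel π) hT hν'
  exact ⟨_, t, isARPair_one hE hA h₁ h₀ _ hT hν' t ht ht',
    exists_projective_of_functional hE hA h₁ h₀ (shortExact_kernel π) hT hν' t ht'⟩

theorem exists_isARPair_one_right (hE : Module.Baer R E) (hA : HasEnoughNakayamaPairs A R E)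
    (V : A) :
    ∃ (X : A) (t : Ext.{w} X V 1 →ₗ[R] E), IsARPair t ∧
      ∃ (K : A) (b : K ⟶ V), Injective K ∧ ∀ (Y : A) (h : Y ⟶ V),
        (∀ e : Ext.{w} X Y 1, t (e.comp (Ext.mk₀ h) (add_zero 1)) = 0) →
          ∃ a : Y ⟶ K, a ≫ b = h := by
  obtain ⟨P₁, I₁, t₁, ι, h₁, _⟩ := hA.exists_mono V
  obtain ⟨P₀, I₀, t₀, m, h₀, _⟩ := hA.exists_mono (cokernel ι)
  obtain ⟨d, hd⟩ := h₁.exists_comap (t₀ := t₀) (cokernel.π ι ≫ m)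
  have hν' : ∀ a : P₀ ⟶ I₁, t₁ (Abelian.factorThruImage d ≫ Abelian.image.ι d ≫ a) =
      t₀ (a ≫ cokernel.π ι ≫ m) := fun a => by
    rw [← Category.assoc, Abelian.image.fac, ← hd]
  have hS : (ShortComplex.mk (Abelian.image.ι d) (cokernel.π d)
      (by rw [← cancel_epi (Abelian.factorThruImage d)]; simp)).ShortExact :=
    { exact := by
        refine ShortComplex.exact_of_g_is_cokernel _ ?_
        exact isCokernelOfComp _ _ (cokernelIsCokernel d) _ (Abelian.image.fac d) }
  obtain ⟨t, ht, ht'⟩ := exists_functional_ext_one.{u, v, w} h₀ hS (shortExact_cokernel ι) hν'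
  exact ⟨_, t, isARPair_one hE hA h₁ h₀ hS _ hν' t ht ht',
    exists_injective_of_functional hE hA h₁ h₀ hS (shortExact_cokernel ι) hν' t ht⟩

/-- Every object has a right approximation by an injective object. -/
theorem exists_injective_approximation (hE : Module.Baer R E)
    (hA : HasEnoughNakayamaPairs A R E) (V : A) :
    ∃ (I : A) (p : I ⟶ V), Injective I ∧
      ∀ (K : A) (g : K ⟶ V), Injective K → ∃ a : K ⟶ I, a ≫ p = g := by
  obtain ⟨X, t, -, I, p, hI, hp⟩ := exists_isARPair_one_right.{u, v, w} hE hA V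
  exact ⟨I, p, hI, fun K g hK => hp K g fun e => by
    rw [ext_eq_zero_of_injective hK one_pos e, Ext.zero_comp, map_zero]⟩

/-- Ext¹ out of a projective vanishes, so the pairing annihilates every morphism from X to a
projective; all of these factor through the single projective given by `exists_isARPair_one_left`.
-/
theorem exists_projective_approximation (hE : Module.Baer R E)
    (hA : HasEnoughNakayamaPairs A R E) (X : A) :
    ∃ (P : A) (i : X ⟶ P), Projective P ∧
      ∀ (K : A) (g : X ⟶ K), Projective K → ∃ a : P ⟶ K, i ≫ a = g := by
  obtain ⟨V, t, -, P, i, hP, hi⟩ := exists_isARPair_one_left.{u, v, w} hE hA X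
  exact ⟨P, i, hP, fun K g hK => hi K g fun e => by
    rw [ext_eq_zero_of_projective hK one_pos e, Ext.comp_zero, map_zero]⟩

/-- Dimension shift in the second variable. -/
theorem bijective_postcomp_extClass {S : ShortComplex A} (hS : S.ShortExact)
    (hI : Injective S.X₂) (X : A) {j : ℕ} (hj : 0 < j) :
    Function.Bijective (hS.extClass.postcompOfLinear R X (rfl : j + 1 = j + 1)) := by
  constructor
  · rw [injective_iff_map_eq_zero]
    intro e he
    obtain ⟨x, rfl⟩ := Ext.covariant_sequence_exact₃ X hS e rfl he
    rw [ext_eq_zero_of_injective hI hj x, Ext.zero_comp]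
  · intro e
    exact Ext.covariant_sequence_exact₁ X hS e (ext_eq_zero_of_injective hI (by lia) _) rfl

theorem bijective_precomp_extClass {S : ShortComplex A} (hS : S.ShortExact)
    (hP : Projective S.X₂) (Y : A) {j : ℕ} (hj : 0 < j) :
    Function.Bijective (hS.extClass.precompOfLinear R Y (add_comm 1 j)) := by
  constructor
  · rw [injective_iff_map_eq_zero]
    intro e he
    obtain ⟨x, rfl⟩ := Ext.contravariant_sequence_exact₁ hS Y e (add_comm 1 j) he
    rw [ext_eq_zero_of_projective hP hj x, Ext.comp_zero]
  · intro e
    exact Ext.contravariant_sequence_exact₃ hS Y e (ext_eq_zero_of_projective hP (by lia) _)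
      (add_comm 1 j)

/-- The functional on `Ext^{j+1}(X, V')` obtained by dimension shift. -/
theorem exists_shift_right {S : ShortComplex A} (hS : S.ShortExact) (hI : Injective S.X₂)
    {X : A} {j : ℕ} (hj : 0 < j) (t : Ext.{w} X S.X₃ j →ₗ[R] E) :
    ∃ t' : Ext.{w} X S.X₁ (j + 1) →ₗ[R] E, ∀ e, t' (e.comp hS.extClass rfl) = t e := by
  let f := LinearEquiv.ofBijective _ (bijective_postcomp_extClass (R := R) hS hI X hj)
  exact ⟨t ∘ₗ f.symm.toLinearMap, fun e => congrArg t (f.symm_apply_apply e)⟩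

theorem exists_shift_left {S : ShortComplex A} (hS : S.ShortExact) (hP : Projective S.X₂)
    {Y : A} {j : ℕ} (hj : 0 < j) (t : Ext.{w} S.X₁ Y j →ₗ[R] E) :
    ∃ t' : Ext.{w} S.X₃ Y (j + 1) →ₗ[R] E,
      ∀ e, t' (hS.extClass.comp e (add_comm 1 j)) = t e := by
  let f := LinearEquiv.ofBijective _ (bijective_precomp_extClass (R := R) hS hP Y hj)
  exact ⟨t ∘ₗ f.symm.toLinearMap, fun e => congrArg t (f.symm_apply_apply e)⟩

/-- Dimension shift along an injective right approximation of `V`. -/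
theorem IsARPair.shift_right (hA : HasEnoughNakayamaPairs A R E) {S : ShortComplex A}
    (hS : S.ShortExact) (hI : Injective S.X₂)
    (happ : ∀ (K : A) (g : K ⟶ S.X₃), Injective K → ∃ a : K ⟶ S.X₂, a ≫ S.g = g)
    {X : A} {j : ℕ} (hj : 0 < j) {t : Ext.{w} X S.X₃ j →ₗ[R] E} (ht : IsARPair t)
    {t' : Ext.{w} X S.X₁ (j + 1) →ₗ[R] E} (ht' : ∀ e, t' (e.comp hS.extClass rfl) = t e) :
    IsARPair t' where
  surj_left Y φ := by
    obtain ⟨P, J, _, i, hJ, _⟩ := hA.exists_mono Y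
    have hJ := hJ.injective
    have hC := shortExact_cokernel i
    -- Embedding Y in an injective J identifies Ext^{j+1}(X, Y) with Ext^j(X, J/Y). The representing
    -- morphism on J/Y is lifted on J by the approximation property and then restricted to Y.
    obtain ⟨g, hg⟩ := ht.surj_left (cokernel i)
      (φ ∘ₗ hC.extClass.postcompOfLinear R X (rfl : j + 1 = j + 1))
    obtain ⟨l, hl⟩ := happ J (cokernel.π i ≫ g) hJ
    have := hS.mono_f
    obtain ⟨h, hh⟩ : ∃ h : Y ⟶ S.X₁, h ≫ S.f = i ≫ l :=
      ⟨hS.exact.lift (i ≫ l) (by simp [hl]), hS.exact.lift_f _ _⟩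
    refine ⟨h, fun e => ?_⟩
    obtain ⟨x, rfl⟩ := (bijective_postcomp_extClass (R := R) hC hJ X hj).2 e
    have hc := ShortComplex.ShortExact.extClass_naturality.{w} hC hS
      { τ₁ := h, τ₂ := l, τ₃ := g, comm₁₂ := hh, comm₂₃ := hl }
    refine (congrArg t' ?_).trans ((ht' (x.comp (Ext.mk₀ g) (add_zero j))).trans (hg x))
    dsimp at hc
    change (x.comp hC.extClass rfl).comp (Ext.mk₀ h) (add_zero _) = _
    rw [Ext.comp_assoc_of_third_deg_zero, hc, Ext.comp_assoc_of_second_deg_zero]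
  inj_left Y h hh := by
    obtain ⟨P, J, _, i, hJ, _⟩ := hA.exists_mono Y
    have hJ := hJ.injective
    have hC := shortExact_cokernel i
    let l : J ⟶ S.X₂ := Injective.factorThru (h ≫ S.f) i
    have hl : i ≫ l = h ≫ S.f := Injective.comp_factorThru _ _
    let g : cokernel i ⟶ S.X₃ := cokernel.desc i (l ≫ S.g) (by
      rw [← Category.assoc, hl, Category.assoc, S.zero, comp_zero])
    have hg : cokernel.π i ≫ g = l ≫ S.g := cokernel.π_desc _ _ _
    have hc := ShortComplex.ShortExact.extClass_naturality.{w} hC hS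
      { τ₁ := h, τ₂ := l, τ₃ := g, comm₁₂ := hl.symm, comm₂₃ := hg.symm }
    obtain ⟨K, a, b, hK, hab⟩ := ht.inj_left _ g fun x => by
      rw [← ht', Ext.comp_assoc_of_second_deg_zero]
      dsimp at hc
      rw [← hc, ← Ext.comp_assoc_of_third_deg_zero]
      exact hh _
    -- The factorization through K now passes through the approximation. Subtracting it from `l`
    -- leaves the restriction to Y unchanged and makes the difference land in the kernel, so `h`
    -- extends to J.
    obtain ⟨b', rfl⟩ := happ K b hK
    have := hS.mono_f
    let k : J ⟶ S.X₁ := hS.exact.lift (l - cokernel.π i ≫ a ≫ b') (by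
      rw [Preadditive.sub_comp, ← hg, ← hab]; simp)
    refine ⟨J, i, k, hJ, ?_⟩
    rw [← cancel_mono S.f, Category.assoc, hS.exact.lift_f, Preadditive.comp_sub, hl]
    simp
  surj_right Y φ := by
    obtain ⟨f, hf⟩ := ht.surj_right Y
      (φ ∘ₗ hS.extClass.postcompOfLinear R Y (rfl : j + 1 = j + 1))
    refine ⟨f, fun e => ?_⟩
    obtain ⟨x, rfl⟩ := (bijective_postcomp_extClass (R := R) hS hI Y hj).2 e
    refine (congrArg t' ?_).trans ((ht' ((Ext.mk₀ f).comp x (zero_add j))).trans (hf x))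
    exact (Ext.comp_assoc _ _ _ (zero_add j) rfl (by lia)).symm
  inj_right Y f hf := by
    refine ht.inj_right Y f fun x => ?_
    rw [← ht', Ext.comp_assoc _ _ _ (zero_add j) rfl (by lia)]
    exact hf _

/-- Dimension shift along a projective left approximation of `X`. -/
theorem IsARPair.shift_left (hA : HasEnoughNakayamaPairs A R E) {S : ShortComplex A}
    (hS : S.ShortExact) (hP : Projective S.X₂)
    (happ : ∀ (K : A) (g : S.X₁ ⟶ K), Projective K → ∃ a : S.X₂ ⟶ K, S.f ≫ a = g)
    {V : A} {j : ℕ} (hj : 0 < j) {t : Ext.{w} S.X₁ V j →ₗ[R] E} (ht : IsARPair t)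
    {t' : Ext.{w} S.X₃ V (j + 1) →ₗ[R] E}
    (ht' : ∀ e, t' (hS.extClass.comp e (add_comm 1 j)) = t e) :
    IsARPair t' where
  surj_right Y φ := by
    obtain ⟨Q, I, _, p, hQ, _⟩ := hA.exists_epi Y
    have hQ := hQ.projective
    have hC := shortExact_kernel p
    obtain ⟨g, hg⟩ := ht.surj_right (kernel p)
      (φ ∘ₗ hC.extClass.precompOfLinear R V (add_comm 1 j))
    obtain ⟨l, hl⟩ := happ Q (g ≫ kernel.ι p) hQ
    have := hS.epi_g
    obtain ⟨h, hh⟩ : ∃ h : S.X₃ ⟶ Y, S.g ≫ h = l ≫ p :=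
      ⟨hS.exact.desc (l ≫ p) (by simp [reassoc_of% hl]), hS.exact.g_desc _ _⟩
    refine ⟨h, fun e => ?_⟩
    obtain ⟨x, rfl⟩ := (bijective_precomp_extClass (R := R) hC hQ V hj).2 e
    have hc := ShortComplex.ShortExact.extClass_naturality.{w} hS hC
      { τ₁ := g, τ₂ := l, τ₃ := h, comm₁₂ := hl.symm, comm₂₃ := hh.symm }
    refine (congrArg t' ?_).trans ((ht' ((Ext.mk₀ g).comp x (zero_add j))).trans (hg x))
    dsimp at hc
    change (Ext.mk₀ h).comp (hC.extClass.comp x (add_comm 1 j)) (zero_add _) = _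
    rw [← Ext.comp_assoc _ _ _ (zero_add 1) (add_comm 1 j) (by lia), ← hc,
      Ext.comp_assoc_of_second_deg_zero]
  inj_right Y h hh := by
    obtain ⟨Q, I, _, p, hQ, _⟩ := hA.exists_epi Y
    have hQ := hQ.projective
    have hC := shortExact_kernel p
    let l : S.X₂ ⟶ Q := Projective.factorThru (S.g ≫ h) p
    have hl : l ≫ p = S.g ≫ h := Projective.factorThru_comp _ _
    let g : S.X₁ ⟶ kernel p := kernel.lift p (S.f ≫ l) (by
      rw [Category.assoc, hl, ← Category.assoc, S.zero, zero_comp])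
    have hg : g ≫ kernel.ι p = S.f ≫ l := kernel.lift_ι _ _ _
    have hc := ShortComplex.ShortExact.extClass_naturality.{w} hS hC
      { τ₁ := g, τ₂ := l, τ₃ := h, comm₁₂ := hg, comm₂₃ := hl }
    obtain ⟨K, a, b, hK, hab⟩ := ht.inj_right _ g fun x => by
      rw [← ht', ← Ext.comp_assoc_of_second_deg_zero]
      dsimp at hc
      rw [hc, Ext.comp_assoc _ _ _ (zero_add 1) (add_comm 1 j) (by lia)]
      exact hh _
    obtain ⟨a', rfl⟩ := happ K a hK
    have := hS.epi_g
    let k : S.X₃ ⟶ Q := hS.exact.desc (l - a' ≫ b ≫ kernel.ι p) (by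
      rw [Preadditive.comp_sub, ← hg, ← hab]; simp)
    refine ⟨Q, k, p, hQ, ?_⟩
    rw [← cancel_epi S.g, ← Category.assoc, hS.exact.g_desc, Preadditive.sub_comp, hl]
    simp
  surj_left Y φ := by
    obtain ⟨f, hf⟩ := ht.surj_left Y
      (φ ∘ₗ hS.extClass.precompOfLinear R Y (add_comm 1 j))
    refine ⟨f, fun e => ?_⟩
    obtain ⟨x, rfl⟩ := (bijective_precomp_extClass (R := R) hS hP Y hj).2 e
    refine (congrArg t' ?_).trans ((ht' (x.comp (Ext.mk₀ f) (add_zero j))).trans (hf x))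
    exact Ext.comp_assoc_of_third_deg_zero _ _ _ _
  inj_left Y f hf := by
    refine ht.inj_left Y f fun x => ?_
    rw [← ht', ← Ext.comp_assoc_of_third_deg_zero]
    exact hf _

end Steps

/-! ### Translates inside a cluster tilting subcategory -/

section Tilting

universe w' w''

variable {A : Type u} [Category.{v} A] [Abelian A] [HasExt.{max u v} A] {n : ℕ}
  {M : ObjectProperty A}

theorem IsNClusterTilting.of_projective (hM : IsNClusterTilting n M) {P : A} (hP : Projective P) :
    M P :=
  (hM.left_perp P).2 fun _ _ _ hi _ => subsingleton_of_forall_eq 0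
    (ext_eq_zero_of_projective hP hi)

theorem IsNClusterTilting.of_injective (hM : IsNClusterTilting n M) {I : A} (hI : Injective I) :
    M I :=
  (hM.right_perp I).2 fun _ _ _ hi _ => subsingleton_of_forall_eq 0
    (ext_eq_zero_of_injective hI hi)

variable {R : Type w'} [CommRing R] [Linear R A] {E : Type w''} [AddCommGroup E] [Module R E]

/-- Induction on the degree, V being replaced each time by the kernel of its injective
approximation. The vanishing range grows by one per step, so for j = n it is exactly the range
defining M. -/
theorem IsNClusterTilting.exists_isARPair_left (hM : IsNClusterTilting n M)
    (hE : Module.Baer R E) (hA : HasEnoughNakayamaPairs A R E) {X : A} (hX : M X) {j : ℕ}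
    (hj : 1 ≤ j) (hjn : j ≤ n) :
    ∃ (V : A) (t : Ext.{max u v} X V j →ₗ[R] E), IsARPair t ∧
      ∀ Y : A, M Y → ∀ i : ℕ, 0 < i → i < j → Subsingleton (Ext.{max u v} Y V i) := by
  induction j, hj using Nat.le_induction with
  | base =>
    obtain ⟨V, t, ht, -⟩ := exists_isARPair_one_left.{u, v, max u v} hE hA X
    exact ⟨V, t, ht, fun _ _ i hi hi' => by lia⟩
  | succ j hj ih =>
    obtain ⟨V, t, ht, hV⟩ := ih (by lia)
    obtain ⟨I, p, hI, happ⟩ := exists_injective_approximation.{u, v, max u v} hE hA V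
    have hlift (Y : A) (hY : M Y) (g : Y ⟶ V) : ∃ a : Y ⟶ I, a ≫ p = g := by
      obtain ⟨K, a, b, hK, rfl⟩ := ht.inj_left Y g fun e => by
        have := (hM.right_perp Y).1 hY X hX j hj (by lia)
        rw [Subsingleton.elim e 0, Ext.zero_comp, map_zero]
      obtain ⟨c, rfl⟩ := happ K b hK
      exact ⟨a ≫ c, Category.assoc _ _ _⟩
    obtain ⟨P, _, _, q, hP, _⟩ := hA.exists_epi V
    obtain ⟨a, ha⟩ := hlift P (hM.of_projective hP.projective) q
    have : Epi p := by
      have : Epi (a ≫ p) := by rw [ha]; infer_instance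
      exact epi_of_epi a p
    have hS := shortExact_kernel p
    obtain ⟨t', ht'⟩ := exists_shift_right hS hI hj t
    refine ⟨_, t', ht.shift_right hA hS hI happ hj ht', fun Y hY i hi hij => ?_⟩
    refine subsingleton_of_forall_eq 0 fun e => ?_
    -- For i = 1 the connecting map is onto, but it vanishes since morphisms Y → V lift to I. For i
    -- > 1 dimension shift lowers both the degree and the object.
    obtain rfl | hi := (show 1 ≤ i from hi).eq_or_lt
    · obtain ⟨b, rfl⟩ := exists_comp_extClass_eq hS hI e
      obtain ⟨c, rfl⟩ := hlift Y hY b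
      rw [← Ext.mk₀_comp_mk₀_assoc]
      erw [hS.comp_extClass]
      rw [Ext.comp_zero]
    · obtain ⟨i, rfl⟩ := Nat.exists_eq_succ_of_ne_zero (show i ≠ 0 by lia)
      have := hV Y hY i (by lia) (by lia)
      obtain ⟨x, rfl⟩ := (bijective_postcomp_extClass (R := R) hS hI Y (by lia)).2 e
      rw [Subsingleton.elim x 0, map_zero]

theorem IsNClusterTilting.exists_isARPair_right (hM : IsNClusterTilting n M)
    (hE : Module.Baer R E) (hA : HasEnoughNakayamaPairs A R E) {V : A} (hV : M V) {j : ℕ}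
    (hj : 1 ≤ j) (hjn : j ≤ n) :
    ∃ (X : A) (t : Ext.{max u v} X V j →ₗ[R] E), IsARPair t ∧
      ∀ Y : A, M Y → ∀ i : ℕ, 0 < i → i < j → Subsingleton (Ext.{max u v} X Y i) := by
  induction j, hj using Nat.le_induction with
  | base =>
    obtain ⟨X, t, ht, -⟩ := exists_isARPair_one_right.{u, v, max u v} hE hA V
    exact ⟨X, t, ht, fun _ _ i hi hi' => by lia⟩
  | succ j hj ih =>
    obtain ⟨X, t, ht, hX⟩ := ih (by lia)
    obtain ⟨P, p, hP, happ⟩ := exists_projective_approximation.{u, v, max u v} hE hA X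
    have hlift (Y : A) (hY : M Y) (g : X ⟶ Y) : ∃ a : P ⟶ Y, p ≫ a = g := by
      obtain ⟨K, a, b, hK, rfl⟩ := ht.inj_right Y g fun e => by
        have := (hM.left_perp Y).1 hY V hV j hj (by lia)
        rw [Subsingleton.elim e 0, Ext.comp_zero, map_zero]
      obtain ⟨c, rfl⟩ := happ K a hK
      exact ⟨c ≫ b, (Category.assoc _ _ _).symm⟩
    obtain ⟨_, I, _, q, hI, _⟩ := hA.exists_mono X
    obtain ⟨a, ha⟩ := hlift I (hM.of_injective hI.injective) q
    have : Mono p := by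
      have : Mono (p ≫ a) := by rw [ha]; infer_instance
      exact mono_of_mono p a
    have hS := shortExact_cokernel p
    obtain ⟨t', ht'⟩ := exists_shift_left hS hP hj t
    refine ⟨_, t', ht.shift_left hA hS hP happ hj ht', fun Y hY i hi hij => ?_⟩
    refine subsingleton_of_forall_eq 0 fun e => ?_
    obtain rfl | hi := (show 1 ≤ i from hi).eq_or_lt
    · obtain ⟨b, rfl⟩ := exists_extClass_comp_eq hS hP e
      obtain ⟨c, rfl⟩ := hlift Y hY b
      rw [← Ext.mk₀_comp_mk₀]
      exact ShortComplex.ShortExact.extClass_comp_assoc hS (Ext.mk₀ c)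
    · obtain ⟨i, rfl⟩ := Nat.exists_eq_succ_of_ne_zero (show i ≠ 0 by lia)
      have := hX Y hY i (by lia) (by lia)
      obtain ⟨x, rfl⟩ := (bijective_precomp_extClass (R := R) hS hP Y (by lia)).2 e
      rw [Subsingleton.elim x 0, map_zero]

theorem IsNClusterTilting.exists_translate (hM : IsNClusterTilting n M) (hn : 1 ≤ n)
    (hE : Module.Baer R E) (hA : HasEnoughNakayamaPairs A R E) {X : A} (hX : M X) :
    ∃ (V : A) (t : Ext.{max u v} X V n →ₗ[R] E), M V ∧ IsARPair t := by
  obtain ⟨V, t, ht, hV⟩ := hM.exists_isARPair_left hE hA hX hn le_rfl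
  exact ⟨V, t, (hM.right_perp V).2 hV, ht⟩

theorem IsNClusterTilting.exists_inverse_translate (hM : IsNClusterTilting n M) (hn : 1 ≤ n)
    (hE : Module.Baer R E) (hA : HasEnoughNakayamaPairs A R E) {V : A} (hV : M V) :
    ∃ (X : A) (t : Ext.{max u v} X V n →ₗ[R] E), M X ∧ IsARPair t := by
  obtain ⟨X, t, ht, hX⟩ := hM.exists_isARPair_right hE hA hV hn le_rfl
  exact ⟨X, t, (hM.left_perp X).2 hX, ht⟩

end Tilting

/-! ### Matlis duality over a commutative artinian ring -/

section Matlis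

universe w

variable {R E : Type u} [CommRing R] [AddCommGroup E] [Module R E]

theorem mem_jacobson_of_mul_self_mem {a : R} (ha : a * a ∈ Ring.jacobson R) :
    a ∈ Ring.jacobson R := by
  rw [Ring.jacobson_eq_sInf_isMaximal, Submodule.mem_sInf] at ha ⊢
  exact fun I hI => ((Set.mem_ofPred.1 hI).isPrime.mem_or_mem (ha I hI)).elim id id

variable {ι : (R ⧸ Ring.jacobson R) →ₗ[R] E}

theorem IsInjectiveEnvelope.mem_range_of_simple (hι : IsInjectiveEnvelope ι) {S : Type w}
    [AddCommGroup S] [Module R S] [IsSimpleModule R S] (f : S →ₗ[R] E) (s : S) :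
    f s ∈ LinearMap.range ι := by
  by_cases hf : f = 0
  · simp [hf]
  have hne : LinearMap.range f ⊓ LinearMap.range ι ≠ ⊥ := fun h =>
    hf (LinearMap.range_eq_bot.1 (hι.essential _ h))
  obtain ⟨y, ⟨⟨s', rfl⟩, hy⟩, hy0⟩ := Submodule.exists_mem_ne_zero_of_ne_bot hne
  have hs' : s' ≠ 0 := by rintro rfl; exact hy0 (map_zero f)
  obtain ⟨r, rfl⟩ := IsSimpleModule.toSpanSingleton_surjective R hs' s
  rw [LinearMap.toSpanSingleton_apply, map_smul]
  exact Submodule.smul_mem _ _ hy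

/-- The dual of a simple module is zero or simple. -/
theorem IsInjectiveEnvelope.length_dual_simple_le (hι : IsInjectiveEnvelope ι) {S : Type w}
    [AddCommGroup S] [Module R S] [IsSimpleModule R S] : Module.length R (S →ₗ[R] E) ≤ 1 := by
  cases subsingleton_or_nontrivial (S →ₗ[R] E) with
  | inl h => rw [Module.length_eq_zero]; exact zero_le_one
  | inr h =>
    suffices IsSimpleModule R (S →ₗ[R] E) from (Module.length_eq_one R _).le
    refine isSimpleModule_iff_toSpanSingleton_surjective.2 ⟨h, fun f hf g => ?_⟩
    have := IsSimpleModule.nontrivial R S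
    obtain ⟨s, hs⟩ := exists_ne (0 : S)
    have hspan := IsSimpleModule.toSpanSingleton_surjective R hs
    obtain ⟨a, ha⟩ := hι.mem_range_of_simple f s
    obtain ⟨b, hb⟩ := hι.mem_range_of_simple g s
    obtain ⟨a, rfl⟩ := Submodule.Quotient.mk_surjective _ a
    obtain ⟨b, rfl⟩ := Submodule.Quotient.mk_surjective _ b
    have key (r : R) (hr : r • s = 0) (h : S →ₗ[R] E) (c : R ⧸ Ring.jacobson R) (hc : ι c = h s) :
        r • c = 0 := hι.injective (by rw [map_smul, hc, ← map_smul, hr, map_zero, map_zero])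
    -- If `a` kills `s`, it also kills its own class in R / rad R, so a² and hence a lies in the
    -- radical. This forces f(s) = 0.
    have has : a • s ≠ 0 := fun h0 => by
      have h1 := key a h0 f _ ha
      rw [← Submodule.Quotient.mk_smul, Submodule.Quotient.mk_eq_zero] at h1
      have h2 := (Submodule.Quotient.mk_eq_zero _).2 (mem_jacobson_of_mul_self_mem h1)
      rw [h2, map_zero] at ha
      refine hf (LinearMap.ext fun x => ?_)
      obtain ⟨r, rfl⟩ := hspan x
      rw [LinearMap.toSpanSingleton_apply, map_smul, ← ha, smul_zero, LinearMap.zero_apply]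
    obtain ⟨c, hc⟩ := IsSimpleModule.toSpanSingleton_surjective R has s
    rw [LinearMap.toSpanSingleton_apply] at hc
    -- Since c a s = s, the element 1 - c a also kills the class of `b`. Hence b = (c b) a modulo
    -- the radical, and g = (c b) f.
    have h1 := key (1 - c * a) (by rw [sub_smul, one_smul, mul_smul, hc, sub_self]) g _ hb
    refine ⟨c * b, LinearMap.ext fun x => ?_⟩
    obtain ⟨r, rfl⟩ := hspan x
    rw [sub_smul, one_smul, sub_eq_zero] at h1
    rw [LinearMap.toSpanSingleton_apply, LinearMap.toSpanSingleton_apply, map_smul, map_smul,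
      LinearMap.smul_apply, ← ha, ← hb, h1, ← map_smul, ← Submodule.Quotient.mk_smul,
      ← Submodule.Quotient.mk_smul]
    rw [smul_eq_mul, smul_eq_mul, mul_right_comm]

/-- E is a cogenerator: Rx has a simple quotient R/m, which embeds in the semisimple module R / rad
R and so in E. Injectivity of E extends the resulting functional to N. -/
theorem IsInjectiveEnvelope.exists_apply_ne_zero [IsArtinianRing R] (hι : IsInjectiveEnvelope ι) {N : Type w}
    [AddCommGroup N] [Module R N] {x : N} (hx : x ≠ 0) : ∃ f : N →ₗ[R] E, f x ≠ 0 := by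
  have hE : Module.Baer R E := Module.Baer.of_injective hι.injective_module
  let I : Ideal R := LinearMap.ker (LinearMap.toSpanSingleton R N x)
  have hI : I ≠ ⊤ := fun h => hx (by
    have : (1 : R) ∈ I := h ▸ Submodule.mem_top
    simpa [I] using this)
  obtain ⟨m, hm, hIm⟩ := Ideal.exists_le_maximal I hI
  have hJ : Ring.jacobson R ≤ m := Ring.jacobson_le_of_isMaximal m
  have : IsSemisimpleModule R (R ⧸ Ring.jacobson R) :=
    (IsArtinian.isSemisimpleModule_iff_jacobson R _).2 (Module.jacobson_quotient_jacobson R R)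
  have : IsSimpleModule R (R ⧸ m) := isSimpleModule_iff_isCoatom.2 hm.out
  have : IsSemisimpleModule R (R ⧸ m) := inferInstance
  let π : (R ⧸ Ring.jacobson R) →ₗ[R] (R ⧸ m) := Submodule.factor hJ
  obtain ⟨σ, hσ⟩ := IsSemisimpleModule.lifting_property π
    (Submodule.factor_surjective hJ) (LinearMap.id)
  obtain ⟨ψ, hψ⟩ := exists_comp_eq_of_ker_le hE (LinearMap.toSpanSingleton R N x)
    (ι ∘ₗ σ ∘ₗ m.mkQ) (fun r hr => by
      have : m.mkQ r = 0 := (Submodule.Quotient.mk_eq_zero _).2 (hIm hr)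
      simp [this])
  refine ⟨ψ, fun h => ?_⟩
  have h1 := hψ 1
  rw [LinearMap.toSpanSingleton_apply, one_smul, h] at h1
  have h2 : σ (m.mkQ 1) = 0 := hι.injective (by rw [map_zero]; exact h1.symm)
  have h3 : m.mkQ 1 = 0 := by
    have := LinearMap.congr_fun hσ (m.mkQ 1)
    rw [LinearMap.comp_apply, h2, map_zero] at this
    exact this.symm
  exact hm.ne_top ((Ideal.eq_top_iff_one m).2 ((Submodule.Quotient.mk_eq_zero _).1 h3))

theorem IsInjectiveEnvelope.length_dual_le (hι : IsInjectiveEnvelope ι) {N : Type w}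
    [AddCommGroup N] [Module R N] (hN : IsFiniteLength R N) :
    Module.length R (N →ₗ[R] E) ≤ Module.length R N := by
  have hE : Module.Baer R E := Module.Baer.of_injective hι.injective_module
  induction hN with
  | of_subsingleton => rw [Module.length_eq_zero]; exact zero_le
  | @of_simple_quotient N _ _ N' _ _ ih =>
    have h1 := Module.length_eq_add_of_exact (LinearMap.lcomp R E N'.mkQ)
      (LinearMap.lcomp R E N'.subtype)
      (fun f g h => LinearMap.ext fun x => by
        obtain ⟨x, rfl⟩ := N'.mkQ_surjective x
        exact LinearMap.congr_fun h x)
      (fun f => by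
        obtain ⟨g, hg⟩ := hE.extension_property N'.subtype N'.injective_subtype f
        exact ⟨g, hg⟩)
      (fun f => ⟨fun h => ⟨N'.liftQ f fun x hx => LinearMap.congr_fun h ⟨x, hx⟩,
          LinearMap.ext fun x => rfl⟩, by
        rintro ⟨g, rfl⟩
        ext x
        have : N'.mkQ x = 0 := (Submodule.Quotient.mk_eq_zero _).2 x.2
        simp [this]⟩)
    have h2 := Module.length_eq_add_of_exact N'.subtype N'.mkQ N'.injective_subtype
      N'.mkQ_surjective (LinearMap.exact_subtype_mkQ N')
    rw [h1, h2, add_comm]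
    refine add_le_add ih ?_
    rw [Module.length_eq_one R (N ⧸ N')]
    exact hι.length_dual_simple_le

theorem isFiniteLength_of_finite [IsArtinianRing R] (N : Type w) [AddCommGroup N] [Module R N] [Module.Finite R N] :
    IsFiniteLength R N :=
  isFiniteLength_iff_isNoetherian_isArtinian.2 ⟨inferInstance, inferInstance⟩

theorem IsInjectiveEnvelope.finite_dual [IsArtinianRing R] (hι : IsInjectiveEnvelope ι) (N : Type w)
    [AddCommGroup N] [Module R N] [Module.Finite R N] : Module.Finite R (N →ₗ[R] E) := by
  have h := isFiniteLength_of_finite (R := R) N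
  have h' := Module.length_ne_top_iff.1
    (ne_top_of_le_ne_top (Module.length_ne_top_iff.2 h) (hι.length_dual_le h))
  have := (isFiniteLength_iff_isNoetherian_isArtinian.1 h').1
  infer_instance

/-- Finitely generated modules over a commutative artinian ring are reflexive with respect to
the injective envelope of `R / rad R`. -/
theorem IsInjectiveEnvelope.bijective_eval [IsArtinianRing R] (hι : IsInjectiveEnvelope ι) (N : Type w)
    [AddCommGroup N] [Module R N] [Module.Finite R N] :
    Function.Bijective (LinearMap.applyₗ : N →ₗ[R] (N →ₗ[R] E) →ₗ[R] E) := by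
  have hinj : Function.Injective (LinearMap.applyₗ : N →ₗ[R] (N →ₗ[R] E) →ₗ[R] E) := by
    rw [injective_iff_map_eq_zero]
    intro x hx
    by_contra hx0
    obtain ⟨f, hf⟩ := hι.exists_apply_ne_zero hx0
    exact hf (LinearMap.congr_fun hx f)
  refine ⟨hinj, ?_⟩
  have := hι.finite_dual N
  have := hι.finite_dual (N →ₗ[R] E)
  rw [← LinearMap.range_eq_top]
  by_contra hne
  -- A proper image in the double dual would have smaller length, whereas dualizing twice does not
  -- increase the length of N.
  have h1 := Submodule.length_lt hne
  rw [← (LinearEquiv.ofInjective _ hinj).length_eq] at h1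
  exact (((hι.length_dual_le (isFiniteLength_of_finite _)).trans
    (hι.length_dual_le (isFiniteLength_of_finite _))).trans_lt h1).false

/-- A module whose dual is finitely generated is finitely generated. -/
theorem IsInjectiveEnvelope.finite_of_dual [IsArtinianRing R] (hι : IsInjectiveEnvelope ι) (N : Type w)
    [AddCommGroup N] [Module R N] [Module.Finite R (N →ₗ[R] E)] : Module.Finite R N := by
  have := hι.finite_dual (N →ₗ[R] E)
  refine Module.Finite.of_injective
    (LinearMap.applyₗ : N →ₗ[R] (N →ₗ[R] E) →ₗ[R] E) ?_
  rw [injective_iff_map_eq_zero]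
  intro x hx
  by_contra hx0
  obtain ⟨f, hf⟩ := hι.exists_apply_ne_zero hx0
  exact hf (LinearMap.congr_fun hx f)

end Matlis

/-! ### The trace pairing and Nakayama pairs in mod Λ -/

section NakayamaPairs

universe w' w''

variable {A : Type u} [Category.{v} A] [Abelian A] {R : Type w'} [CommRing R] [Linear R A]
  {E : Type w''} [AddCommGroup E] [Module R E]

/-- If the functionals take values in an injective module, projectivity and injectivity in a
Nakayama pair are automatic. -/
theorem IsNakayamaPair.of_baer (hE : Module.Baer R E) {P I : A} (t : (P ⟶ I) →ₗ[R] E)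
    (surj_left : ∀ (Y : A) (φ : (P ⟶ Y) →ₗ[R] E), ∃ h : Y ⟶ I, ∀ a, t (a ≫ h) = φ a)
    (inj_left : ∀ (Y : A) (h : Y ⟶ I), (∀ a : P ⟶ Y, t (a ≫ h) = 0) → h = 0)
    (surj_right : ∀ (X : A) (φ : (X ⟶ I) →ₗ[R] E), ∃ f : P ⟶ X, ∀ a, t (f ≫ a) = φ a)
    (inj_right : ∀ (X : A) (f : P ⟶ X), (∀ a : X ⟶ I, t (f ≫ a) = 0) → f = 0) :
    IsNakayamaPair t where
  projective := ⟨fun {Y X} f e _ => by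
    -- As `e` is epi, Hom(X, I) embeds in Hom(Y, I). Extending the functional of `f` along this
    -- embedding and representing it gives the lift.
    obtain ⟨ψ, hψ⟩ := exists_comp_eq_of_ker_le hE (Linear.leftComp R I e)
      (t ∘ₗ Linear.leftComp R I f) (fun a ha => by
        have : a = 0 := by rw [← cancel_epi e]; simpa using ha
        simp [this])
    obtain ⟨h, hh⟩ := surj_right _ ψ
    refine ⟨h, sub_eq_zero.1 (inj_right _ _ fun a => ?_)⟩
    have := hψ a
    rw [← hh] at this
    simpa [Preadditive.sub_comp, sub_eq_zero] using this⟩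
  injective := ⟨fun {X Y} f e _ => by
    obtain ⟨ψ, hψ⟩ := exists_comp_eq_of_ker_le hE (Linear.rightComp R P e)
      (t ∘ₗ Linear.rightComp R P f) (fun a ha => by
        have : a = 0 := by rw [← cancel_mono e]; simpa using ha
        simp [this])
    obtain ⟨h, hh⟩ := surj_left _ ψ
    refine ⟨h, sub_eq_zero.1 (inj_left _ _ fun a => ?_)⟩
    have := hψ a
    rw [← hh] at this
    simpa [Preadditive.comp_sub, sub_eq_zero] using this⟩
  surj_left := surj_left
  inj_left := inj_left
  surj_right := surj_right
  inj_right := inj_right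

end NakayamaPairs

section FinMod

variable (R Λ : Type u) [CommRing R] [Ring Λ] [Algebra R Λ]
  (E : Type u) [AddCommGroup E] [Module R E]

/-- The left `Λ`-module `Hom_R(Λ, E)`, with `(a • f) x = f (x a)`. -/
def DualRegular : Type u := Λ →ₗ[R] E

instance : AddCommGroup (DualRegular R Λ E) := inferInstanceAs (AddCommGroup (Λ →ₗ[R] E))

instance : Module R (DualRegular R Λ E) := inferInstanceAs (Module R (Λ →ₗ[R] E))

instance : FunLike (DualRegular R Λ E) Λ E := inferInstanceAs (FunLike (Λ →ₗ[R] E) Λ E)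

variable {R Λ E}

@[ext]
theorem DualRegular.ext {f g : DualRegular R Λ E} (h : ∀ x, f x = g x) : f = g :=
  LinearMap.ext h

instance : SMul Λ (DualRegular R Λ E) where
  smul a f := LinearMap.comp (show Λ →ₗ[R] E from f) (LinearMap.mulRight R a)

theorem DualRegular.smul_apply (a : Λ) (f : DualRegular R Λ E) (x : Λ) : (a • f) x = f (x * a) :=
  rfl

theorem DualRegular.add_apply (f g : DualRegular R Λ E) (x : Λ) : (f + g) x = f x + g x :=
  rfl

theorem DualRegular.map_add (f : DualRegular R Λ E) (x y : Λ) : f (x + y) = f x + f y :=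
  LinearMap.map_add (show Λ →ₗ[R] E from f) x y

theorem DualRegular.map_zero (f : DualRegular R Λ E) : f 0 = 0 :=
  LinearMap.map_zero (show Λ →ₗ[R] E from f)

theorem DualRegular.map_smul (f : DualRegular R Λ E) (r : R) (x : Λ) : f (r • x) = r • f x :=
  LinearMap.map_smul (show Λ →ₗ[R] E from f) r x

instance : Module Λ (DualRegular R Λ E) where
  one_smul f := by ext x; rw [DualRegular.smul_apply, mul_one]
  mul_smul a b f := by ext x; simp only [DualRegular.smul_apply, mul_assoc]
  smul_zero a := rfl
  smul_add a f g := rfl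
  add_smul a b f := by
    ext x
    simp only [DualRegular.smul_apply, DualRegular.add_apply, mul_add, DualRegular.map_add]
  zero_smul f := by
    ext x
    rw [DualRegular.smul_apply, mul_zero, DualRegular.map_zero]
    rfl

instance : IsScalarTower R Λ (DualRegular R Λ E) where
  smul_assoc r a f := by
    ext x
    rw [DualRegular.smul_apply, mul_smul_comm, DualRegular.map_smul]
    rfl

theorem sum_dualRegular_apply {k : ℕ} (s : Finset (Fin k)) (g : Fin k → Fin k → DualRegular R Λ E)
    (j : Fin k) (a : Λ) : ((∑ i ∈ s, g i) j) a = ∑ i ∈ s, (g i j) a := by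
  classical
  induction s using Finset.induction_on with
  | empty => rfl
  | insert i s hi ih =>
    rw [Finset.sum_insert hi, Finset.sum_insert hi, ← ih]
    rfl

variable [IsArtinAlgebra R Λ]

open scoped ModuleCat.Algebra

namespace FinMod

/-- The `Λ`-module underlying an object of `mod Λ`. -/
abbrev toModule (X : FinMod R Λ) : ModuleCat.{u} Λ := (show FGModuleCat.{u} Λ from X).obj

/-- The linear map underlying a morphism of `mod Λ`. -/
def toLin {X Y : FinMod R Λ} (f : X ⟶ Y) : X.toModule →ₗ[Λ] Y.toModule :=
  (show (show FGModuleCat.{u} Λ from X) ⟶ (show FGModuleCat.{u} Λ from Y) from f).hom.hom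

/-- The morphism of `mod Λ` given by a linear map. -/
def ofLin {X Y : FinMod R Λ} (f : X.toModule →ₗ[Λ] Y.toModule) : X ⟶ Y :=
  show (show FGModuleCat.{u} Λ from X) ⟶ (show FGModuleCat.{u} Λ from Y) from
    ObjectProperty.homMk (ModuleCat.ofHom f)

/-- A finitely generated module as an object of `mod Λ`. -/
def of (R : Type u) [CommRing R] [Algebra R Λ] [IsArtinAlgebra R Λ] (V : Type u) [AddCommGroup V]
    [Module Λ V] [Module.Finite Λ V] : FinMod R Λ :=
  FGModuleCat.of Λ V

instance (X : FinMod R Λ) : Module.Finite Λ X.toModule :=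
  (show FGModuleCat.{u} Λ from X).property

instance (X : FinMod R Λ) : Module.Finite R X.toModule :=
  have := IsArtinAlgebra.finite (R := R) (Λ := Λ)
  Module.Finite.trans Λ X.toModule

variable {X Y Z : FinMod R Λ}

@[ext]
theorem hom_ext {f g : X ⟶ Y} (h : ∀ x, toLin f x = toLin g x) : f = g :=
  FGModuleCat.hom_ext (LinearMap.ext h)

@[simp]
theorem toLin_comp (f : X ⟶ Y) (g : Y ⟶ Z) (x : X.toModule) :
    toLin (f ≫ g) x = toLin g (toLin f x) := rfl

@[simp]
theorem toLin_add (f g : X ⟶ Y) (x : X.toModule) : toLin (f + g) x = toLin f x + toLin g x := rfl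

theorem toLin_sum {ι : Type*} (s : Finset ι) (f : ι → (X ⟶ Y)) (x : X.toModule) :
    toLin (∑ i ∈ s, f i) x = ∑ i ∈ s, toLin (f i) x := by
  classical
  induction s using Finset.induction_on with
  | empty => rfl
  | insert i s hi ih => rw [Finset.sum_insert hi, Finset.sum_insert hi, toLin_add, ih]

theorem epi_of_surjective (f : X ⟶ Y) (hf : Function.Surjective (toLin f)) : Epi f :=
  ⟨fun g h e => by
    ext y
    obtain ⟨x, rfl⟩ := hf y
    rw [← toLin_comp, e, toLin_comp]⟩

theorem mono_of_injective (f : X ⟶ Y) (hf : Function.Injective (toLin f)) : Mono f :=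
  ⟨fun g h e => by
    ext x
    apply hf
    rw [← toLin_comp, e, toLin_comp]⟩

end FinMod

end FinMod

section FinModPairs

open scoped ModuleCat.Algebra
open FinMod

variable (R Λ : Type u) [CommRing R] [Ring Λ] [Algebra R Λ]
  (E : Type u) [AddCommGroup E] [Module R E] [IsArtinAlgebra R Λ]

/-- The free module `Λ^k` as an object of `mod Λ`. -/
abbrev freeModule (k : ℕ) : FinMod R Λ := FinMod.of R (Fin k → Λ)

/-- The injective module `Hom_R(Λ, E)^k` as an object of `mod Λ`. -/
abbrev cofreeModule [Module.Finite Λ (DualRegular R Λ E)] (k : ℕ) : FinMod R Λ :=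
  FinMod.of R (Fin k → DualRegular R Λ E)

variable {R Λ E}

/-- The morphism `Λ^k ⟶ Y` which sends the `i`-th basis vector to `y` and the others to zero. -/
def freeSingle {k : ℕ} (i : Fin k) (Y : FinMod R Λ) : Y.toModule →ₗ[R] (freeModule R Λ k ⟶ Y) where
  toFun y := ofLin ((LinearMap.toSpanSingleton Λ Y.toModule y) ∘ₗ LinearMap.proj i)
  map_add' y z := by
    ext (x : Fin k → Λ)
    exact smul_add (x i) y z
  map_smul' r y := by
    ext (x : Fin k → Λ)
    exact smul_comm (x i) r y

theorem toLin_free_apply {k : ℕ} {Y : FinMod R Λ} (f : freeModule R Λ k ⟶ Y) (x : Fin k → Λ) :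
    toLin f x = ∑ i, x i • toLin f (Pi.single i (1 : Λ) : Fin k → Λ) := by
  have h : x = ∑ i, x i • (Pi.single i (1 : Λ) : Fin k → Λ) := by
    ext j
    simp [Finset.sum_apply, Pi.single_apply]
  conv_lhs => rw [h]
  refine (map_sum (toLin f) _ _).trans (Finset.sum_congr rfl fun i _ => ?_)
  exact map_smul (toLin f) _ _

theorem eq_sum_freeSingle {k : ℕ} {Y : FinMod R Λ} (f : freeModule R Λ k ⟶ Y) :
    ∑ i, freeSingle i Y (toLin f (Pi.single i (1 : Λ) : Fin k → Λ)) = f := by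
  ext (x : Fin k → Λ)
  exact (toLin_sum _ _ _).trans (toLin_free_apply f x).symm

/-- The `Λ`-linear map to `Hom_R(Λ, E)` corresponding to an `R`-linear functional. -/
def dualHom {X : FinMod R Λ} (g : X.toModule →ₗ[R] E) : X.toModule →ₗ[Λ] DualRegular R Λ E where
  toFun x := g ∘ₗ (LinearMap.toSpanSingleton Λ X.toModule x).restrictScalars R
  map_add' x y := DualRegular.ext fun a => by
    change g (a • (x + y)) = g (a • x) + g (a • y)
    rw [smul_add, map_add]
  map_smul' a x := DualRegular.ext fun b => by
    change g (b • a • x) = g ((b * a) • x)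
    rw [mul_smul]

theorem dualHom_smul {X : FinMod R Λ} (r : R) (g : X.toModule →ₗ[R] E) (x : X.toModule) :
    dualHom (r • g) x = algebraMap R Λ r • dualHom g x :=
  DualRegular.ext fun a => by
    change r • g (a • x) = g ((a * algebraMap R Λ r) • x)
    have : (a * algebraMap R Λ r) • x = r • a • x := by
      rw [← Algebra.commutes, mul_smul]
      rfl
    rw [this]
    exact (g.map_smul r (a • x)).symm

variable [Module.Finite Λ (DualRegular R Λ E)]

/-- The morphism `X ⟶ Hom_R(Λ, E)^k` whose `i`-th component corresponds to the functional `g` on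
`X`, and whose other components are zero. -/
def cofreeSingle {k : ℕ} (i : Fin k) (X : FinMod R Λ) :
    (X.toModule →ₗ[R] E) →ₗ[R] (X ⟶ cofreeModule R Λ E k) where
  toFun g := ofLin ((LinearMap.single Λ (fun _ : Fin k => DualRegular R Λ E) i) ∘ₗ dualHom g)
  map_add' g h := by
    ext x
    exact (LinearMap.single Λ (fun _ : Fin k => DualRegular R Λ E) i).map_add (dualHom g x)
      (dualHom h x)
  map_smul' r g := by
    ext x
    refine (congrArg (LinearMap.single Λ (fun _ : Fin k => DualRegular R Λ E) i)
      (dualHom_smul r g x)).trans ?_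
    exact (LinearMap.single Λ (fun _ : Fin k => DualRegular R Λ E) i).map_smul
      (algebraMap R Λ r) (dualHom g x)

theorem cofreeSingle_apply {k : ℕ} (i : Fin k) (X : FinMod R Λ) (g : X.toModule →ₗ[R] E)
    (x : X.toModule) (j : Fin k) (a : Λ) :
    ((toLin (cofreeSingle i X g) x : Fin k → DualRegular R Λ E) j) a =
      if j = i then g (a • x) else 0 := by
  change ((Pi.single i _ : Fin k → DualRegular R Λ E) j) a = _
  rw [Pi.single_apply]
  split_ifs <;> rfl

variable (R Λ E) in
/-- The functional on `Hom(Λ^k, Hom_R(Λ, E)^k)` given by the trace. -/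
def nakayamaTrace (k : ℕ) : (freeModule R Λ k ⟶ cofreeModule R Λ E k) →ₗ[R] E where
  toFun f := ∑ i, ((toLin f (Pi.single i (1 : Λ) : Fin k → Λ) : Fin k → DualRegular R Λ E) i) 1
  map_add' f g := by
    rw [← Finset.sum_add_distrib]
    rfl
  map_smul' r f := by
    rw [Finset.smul_sum]
    refine Finset.sum_congr rfl fun i _ => ?_
    change ((toLin f _ : Fin k → DualRegular R Λ E) i) (1 * algebraMap R Λ r) = _
    rw [one_mul, Algebra.algebraMap_eq_smul_one, DualRegular.map_smul]
    rfl

theorem cofree_apply_eq {k : ℕ} {X : FinMod R Λ} (f : X ⟶ cofreeModule R Λ E k) (x : X.toModule)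
    (i : Fin k) (a : Λ) :
    ((toLin f x : Fin k → DualRegular R Λ E) i) a =
      ((toLin f (a • x) : Fin k → DualRegular R Λ E) i) 1 := by
  rw [map_smul]
  change _ = ((toLin f x : Fin k → DualRegular R Λ E) i) (1 * a)
  rw [one_mul]

/-- The functional on `X` corresponding to the `i`-th component of a morphism to
`Hom_R(Λ, E)^k`. -/
def cofreeCoord {k : ℕ} {X : FinMod R Λ} (f : X ⟶ cofreeModule R Λ E k) (i : Fin k) :
    X.toModule →ₗ[R] E where
  toFun x := ((toLin f x : Fin k → DualRegular R Λ E) i) 1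
  map_add' x y := by rw [map_add]; rfl
  map_smul' r x := by
    have : r • x = algebraMap R Λ r • x := rfl
    rw [this, ← cofree_apply_eq, Algebra.algebraMap_eq_smul_one, DualRegular.map_smul]
    rfl

theorem eq_sum_cofreeSingle {k : ℕ} {X : FinMod R Λ} (f : X ⟶ cofreeModule R Λ E k) :
    ∑ i, cofreeSingle i X (cofreeCoord f i) = f := by
  ext x
  refine (toLin_sum _ _ _).trans ?_
  funext j
  refine DualRegular.ext fun a => ?_
  rw [cofree_apply_eq f]
  refine (sum_dualRegular_apply _ _ _ _).trans ?_
  simp_rw [cofreeSingle_apply]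
  rw [Finset.sum_ite_eq, if_pos (Finset.mem_univ _)]
  rfl

theorem nakayamaTrace_comp_cofreeSingle {k : ℕ} {X : FinMod R Λ} (f : freeModule R Λ k ⟶ X)
    (i : Fin k) (g : X.toModule →ₗ[R] E) :
    nakayamaTrace R Λ E k (f ≫ cofreeSingle i X g) =
      g (toLin f (Pi.single i (1 : Λ) : Fin k → Λ)) := by
  change ∑ j, ((toLin (cofreeSingle i X g) (toLin f (Pi.single j (1 : Λ) : Fin k → Λ)) :
    Fin k → DualRegular R Λ E) j) 1 = _
  simp_rw [cofreeSingle_apply]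
  rw [Finset.sum_ite_eq', if_pos (Finset.mem_univ _), one_smul]

theorem nakayamaTrace_freeSingle_comp {k : ℕ} {X : FinMod R Λ} (a : X ⟶ cofreeModule R Λ E k)
    (i : Fin k) (x : X.toModule) :
    nakayamaTrace R Λ E k (freeSingle i X x ≫ a) = cofreeCoord a i x := by
  change ∑ j, ((toLin a ((Pi.single j (1 : Λ) : Fin k → Λ) i • x) :
    Fin k → DualRegular R Λ E) j) 1 = _
  refine (Finset.sum_eq_single i (fun j _ hj => ?_)
    fun h => absurd (Finset.mem_univ i) h).trans ?_
  · rw [Pi.single_eq_of_ne hj.symm, zero_smul, map_zero]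
    rfl
  · rw [Pi.single_eq_same, one_smul]
    rfl

/-- Under Hom(Λ^k, Y) = Y^k and Hom(Y, (DΛ)^k) = (DY)^k the trace pairing becomes the sum of
evaluations. Representing functionals on (DX)^k is reflexivity of X; vanishing of an annihilated
element is the cogenerator property. -/
theorem isNakayamaPair_trace {ι : (R ⧸ Ring.jacobson R) →ₗ[R] E} (hι : IsInjectiveEnvelope ι)
    (k : ℕ) : IsNakayamaPair (nakayamaTrace R Λ E k) := by
  have := IsArtinAlgebra.isArtinianRing (R := R) (Λ := Λ)
  have hE : Module.Baer R E := Module.Baer.of_injective hι.injective_module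
  refine .of_baer hE _ (fun Y φ => ?_) (fun Y h hh => ?_) (fun X φ => ?_) (fun X f hf => ?_)
  · refine ⟨∑ i, cofreeSingle i Y (φ ∘ₗ freeSingle i Y), fun a => ?_⟩
    conv_rhs => rw [← eq_sum_freeSingle a, map_sum]
    rw [Preadditive.comp_sum, map_sum]
    exact Finset.sum_congr rfl fun i _ => nakayamaTrace_comp_cofreeSingle a i _
  · rw [← eq_sum_cofreeSingle h]
    refine Finset.sum_eq_zero fun i _ => ?_
    rw [show cofreeCoord h i = 0 from LinearMap.ext fun y =>
      (nakayamaTrace_freeSingle_comp h i y).symm.trans (hh _), map_zero]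
  · have hx (i : Fin k) : ∃ x : X.toModule, ∀ g : X.toModule →ₗ[R] E,
        g x = φ (cofreeSingle i X g) := by
      obtain ⟨x, hx⟩ := (hι.bijective_eval X.toModule).2 (φ ∘ₗ cofreeSingle i X)
      exact ⟨x, fun g => LinearMap.congr_fun hx g⟩
    choose x hx using hx
    refine ⟨∑ i, freeSingle i X (x i), fun a => ?_⟩
    conv_rhs => rw [← eq_sum_cofreeSingle a, map_sum]
    rw [Preadditive.sum_comp, map_sum]
    exact Finset.sum_congr rfl fun i _ => (nakayamaTrace_freeSingle_comp a i _).trans (hx i _)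
  · rw [← eq_sum_freeSingle f]
    refine Finset.sum_eq_zero fun i _ => ?_
    rw [show toLin f (Pi.single i (1 : Λ) : Fin k → Λ) = 0 from ?_, map_zero]
    by_contra hne
    obtain ⟨g, hg⟩ := hι.exists_apply_ne_zero hne
    exact hg ((nakayamaTrace_comp_cofreeSingle f i g).symm.trans (hf _))

end FinModPairs

section

open scoped ModuleCat.Algebra
open FinMod

variable {R Λ E : Type u} [CommRing R] [Ring Λ] [Algebra R Λ] [AddCommGroup E] [Module R E]
  [IsArtinAlgebra R Λ]

theorem hasEnoughNakayamaPairs_finMod {ι : (R ⧸ Ring.jacobson R) →ₗ[R] E}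
    (hι : IsInjectiveEnvelope ι) : HasEnoughNakayamaPairs (FinMod R Λ) R E := by
  have := IsArtinAlgebra.isArtinianRing (R := R) (Λ := Λ)
  have := IsArtinAlgebra.finite (R := R) (Λ := Λ)
  have : Module.Finite R (DualRegular R Λ E) := hι.finite_dual Λ
  have : Module.Finite Λ (DualRegular R Λ E) := .of_restrictScalars_finite R Λ _
  refine ⟨fun X => ?_, fun X => ?_⟩
  · obtain ⟨k, f, hf⟩ := Module.Finite.exists_fin' Λ X.toModule
    exact ⟨_, _, _, ofLin (X := freeModule R Λ k) f, isNakayamaPair_trace hι k,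
      epi_of_surjective _ hf⟩
  · have := hι.finite_dual X.toModule
    obtain ⟨k, s, hs⟩ := Module.Finite.exists_fin (R := R) (M := X.toModule →ₗ[R] E)
    -- R-generators of DX are the coordinates of the morphism to (DΛ)^k. An element in its kernel is
    -- killed by all of DX, hence is zero.
    refine ⟨_, _, _, ∑ i, cofreeSingle i X (s i), isNakayamaPair_trace hι k,
      mono_of_injective _ ?_⟩
    rw [injective_iff_map_eq_zero]
    intro x hx
    by_contra hx0
    obtain ⟨g, hg⟩ := hι.exists_apply_ne_zero hx0
    have hs' (j : Fin k) : s j x = 0 := by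
      have h1 : ((toLin (∑ i, cofreeSingle i X (s i)) x : Fin k → DualRegular R Λ E) j) 1 = 0 :=
        congrArg (fun y : Fin k → DualRegular R Λ E => y j 1) hx
      rw [toLin_sum] at h1
      replace h1 := (sum_dualRegular_apply _ _ _ _).symm.trans h1
      simp_rw [cofreeSingle_apply] at h1
      rwa [Finset.sum_ite_eq, if_pos (Finset.mem_univ _), one_smul] at h1
    have hle : (⊤ : Submodule R (X.toModule →ₗ[R] E)) ≤ LinearMap.ker (LinearMap.applyₗ x) := by
      rw [← hs, Submodule.span_le]
      rintro _ ⟨j, rfl⟩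
      exact hs' j
    exact hg (hle (Submodule.mem_top (x := g)))

end

/-! ### The translate as a functor between stable categories -/

section Translate

universe w w' w''

variable {A : Type u} [Category.{v} A] [Abelian A] [HasExt.{w} A] {n : ℕ} (hn : 0 < n)
  {M : ObjectProperty A} {R : Type w'} [CommRing R] [Linear R A] {E : Type w''} [AddCommGroup E]
  [Module R E]

/-- The pairing `(h, e) ↦ t (h ∘ e)` of `Hom(Y, V)` and `Ext^n(X, Y)`. -/
def extPairing {X V : A} (t : Ext.{w} X V n →ₗ[R] E) (Y : A) :
    (Y ⟶ V) →ₗ[R] (Ext.{w} X Y n →ₗ[R] E) where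
  toFun h := t ∘ₗ (Ext.mk₀ h).postcompOfLinear R X (add_zero n)
  map_add' h h' := LinearMap.ext fun e => by
    change t (e.comp (Ext.mk₀ (h + h')) (add_zero n)) = _
    rw [Ext.mk₀_add, Ext.comp_add, map_add]
    rfl
  map_smul' r h := LinearMap.ext fun e => by
    change t (e.comp (Ext.mk₀ (r • h)) (add_zero n)) = _
    rw [Ext.mk₀_smul, Ext.comp_smul, map_smul]
    rfl

include hn in
theorem IsARPair.toInjStable_map_eq_iff {X V Y : M.FullSubcategory}
    {t : Ext.{w} X.obj V.obj n →ₗ[R] E} (ht : IsARPair t) (h h' : Y ⟶ V) :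
    (toInjStable M).map h = (toInjStable M).map h' ↔
      ∀ e : Ext.{w} X.obj Y.obj n, t (e.comp (Ext.mk₀ h.hom) (add_zero n)) =
        t (e.comp (Ext.mk₀ h'.hom) (add_zero n)) := by
  have key (e : Ext.{w} X.obj Y.obj n) : e.comp (Ext.mk₀ (h.hom - h'.hom)) (add_zero n) =
      e.comp (Ext.mk₀ h.hom) (add_zero n) - e.comp (Ext.mk₀ h'.hom) (add_zero n) := by
    rw [sub_eq_add_neg, Ext.mk₀_add, Ext.mk₀_neg, Ext.comp_add, Ext.comp_neg, sub_eq_add_neg]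
  rw [Quotient.functor_map_eq_iff]
  constructor
  · rintro ⟨K, a, b, hK, hab⟩ e
    rw [← sub_eq_zero, ← map_sub, ← key, ← hab,
      ext_comp_eq_zero_of_injective hK hn, map_zero]
  · intro H
    obtain ⟨K, a, b, hK, hab⟩ := ht.inj_left Y.obj (h.hom - h'.hom) fun e => by
      rw [key, map_sub, H, sub_self]
    exact ⟨K, a, b, hK, hab⟩

include hn in
theorem IsARPair.toProjStable_map_eq_iff {X V Y : M.FullSubcategory}
    {t : Ext.{w} X.obj V.obj n →ₗ[R] E} (ht : IsARPair t) (f f' : X ⟶ Y) :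
    (toProjStable M).map f = (toProjStable M).map f' ↔
      ∀ e : Ext.{w} Y.obj V.obj n, t ((Ext.mk₀ f.hom).comp e (zero_add n)) =
        t ((Ext.mk₀ f'.hom).comp e (zero_add n)) := by
  have key (e : Ext.{w} Y.obj V.obj n) : (Ext.mk₀ (f.hom - f'.hom)).comp e (zero_add n) =
      (Ext.mk₀ f.hom).comp e (zero_add n) - (Ext.mk₀ f'.hom).comp e (zero_add n) := by
    rw [sub_eq_add_neg, Ext.mk₀_add, Ext.mk₀_neg, Ext.add_comp, Ext.neg_comp, sub_eq_add_neg]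
  rw [Quotient.functor_map_eq_iff]
  constructor
  · rintro ⟨K, a, b, hK, hab⟩ e
    rw [← sub_eq_zero, ← map_sub, ← key, ← hab,
      comp_ext_eq_zero_of_projective hK hn, map_zero]
  · intro H
    obtain ⟨K, a, b, hK, hab⟩ := ht.inj_right Y.obj (f.hom - f'.hom) fun e => by
      rw [key, map_sub, H, sub_self]
    exact ⟨K, a, b, hK, hab⟩

include hn in
theorem IsARPair.exists_leftDual {X V : M.FullSubcategory} {t : Ext.{w} X.obj V.obj n →ₗ[R] E}
    (ht : IsARPair t) (Y : M.FullSubcategory) :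
    ∃ Φ : ((toInjStable M).obj Y ⟶ (toInjStable M).obj V) ≃ₗ[R] (Ext.{w} X.obj Y.obj n →ₗ[R] E),
      ∀ (h : Y ⟶ V) (e : Ext.{w} X.obj Y.obj n),
        Φ ((toInjStable M).map h) e = t (e.comp (Ext.mk₀ h.hom) (add_zero n)) := by
  let p : (Y ⟶ V) →ₗ[R] ((toInjStable M).obj Y ⟶ (toInjStable M).obj V) :=
    { toFun := fun h => (toInjStable M).map h
      map_add' := fun _ _ => rfl
      map_smul' := fun _ _ => rfl }
  let L : (Y ⟶ V) →ₗ[R] (Ext.{w} X.obj Y.obj n →ₗ[R] E) :=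
    extPairing t Y.obj ∘ₗ
      { toFun := fun h => h.hom
        map_add' := fun _ _ => rfl
        map_smul' := fun _ _ => rfl }
  have hL (h : Y ⟶ V) (e : Ext.{w} X.obj Y.obj n) :
      L h e = t (e.comp (Ext.mk₀ h.hom) (add_zero n)) := rfl
  have hp : Function.Surjective p := (toInjStable M).map_surjective
  have hpL (h : Y ⟶ V) : p h = 0 ↔ L h = 0 := by
    have := ht.toInjStable_map_eq_iff hn h 0
    rw [Functor.map_zero] at this
    refine this.trans ⟨fun H => LinearMap.ext fun e => (H e).trans ?_, fun H e => ?_⟩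
    · change t (e.comp (Ext.mk₀ 0) (add_zero n)) = 0
      rw [Ext.mk₀_zero, Ext.comp_zero, map_zero]
    · change L h e = t (e.comp (Ext.mk₀ 0) (add_zero n))
      rw [H, Ext.mk₀_zero, Ext.comp_zero, map_zero, LinearMap.zero_apply]
  obtain ⟨Φ, hΦ⟩ := exists_comp_eq_of_surjective p hp L fun h => (hpL h).1
  refine ⟨LinearEquiv.ofBijective Φ ⟨?_, fun φ => ?_⟩,
    fun h e => (LinearMap.congr_fun (hΦ h) e).trans (hL h e)⟩
  · rw [injective_iff_map_eq_zero]
    intro x hx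
    obtain ⟨h, rfl⟩ := hp x
    rw [hpL, ← hΦ, hx]
  · obtain ⟨h, hh⟩ := ht.surj_left Y.obj φ
    exact ⟨p (ObjectProperty.homMk h), (hΦ _).trans (LinearMap.ext hh)⟩

/-- The dual of `Ext^n(X, Y)` as the space of morphisms from `Y` to the translate of `X`, modulo
morphisms factoring through injectives. -/
def IsARPair.leftDual {X V : M.FullSubcategory} {t : Ext.{w} X.obj V.obj n →ₗ[R] E}
    (ht : IsARPair t) (Y : M.FullSubcategory) :
    ((toInjStable M).obj Y ⟶ (toInjStable M).obj V) ≃ₗ[R] (Ext.{w} X.obj Y.obj n →ₗ[R] E) :=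
  (ht.exists_leftDual hn Y).choose

theorem IsARPair.leftDual_map {X V : M.FullSubcategory} {t : Ext.{w} X.obj V.obj n →ₗ[R] E}
    (ht : IsARPair t) {Y : M.FullSubcategory} (h : Y ⟶ V) (e : Ext.{w} X.obj Y.obj n) :
    ht.leftDual hn Y ((toInjStable M).map h) e = t (e.comp (Ext.mk₀ h.hom) (add_zero n)) :=
  (ht.exists_leftDual hn Y).choose_spec h e

theorem IsARPair.leftDual_comp {X V : M.FullSubcategory} {t : Ext.{w} X.obj V.obj n →ₗ[R] E}
    (ht : IsARPair t) {Y Z : M.FullSubcategory} (g : Y ⟶ Z)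
    (h : (toInjStable M).obj Z ⟶ (toInjStable M).obj V) (e : Ext.{w} X.obj Y.obj n) :
    ht.leftDual hn Y ((toInjStable M).map g ≫ h) e =
      ht.leftDual hn Z h (e.comp (Ext.mk₀ g.hom) (add_zero n)) := by
  obtain ⟨h, rfl⟩ := (toInjStable M).map_surjective h
  rw [← Functor.map_comp, leftDual_map, leftDual_map, Ext.comp_assoc_of_third_deg_zero,
    Ext.mk₀_comp_mk₀]
  rfl

variable {T : M.FullSubcategory → M.FullSubcategory}
  {t : ∀ X, Ext.{w} X.obj (T X).obj n →ₗ[R] E} (ht : ∀ X, IsARPair (t X))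

/-- The action of the translate on morphisms. -/
def translateMap {X X' : M.FullSubcategory} (f : X ⟶ X') :
    (toInjStable M).obj (T X) ⟶ (toInjStable M).obj (T X') :=
  ((ht X').leftDual hn (T X)).symm (t X ∘ₗ (Ext.mk₀ f.hom).precompOfLinear R _ (zero_add n))

theorem leftDual_translateMap {X X' : M.FullSubcategory} (f : X ⟶ X')
    (e : Ext.{w} X'.obj (T X).obj n) :
    (ht X').leftDual hn (T X) (translateMap hn ht f) e =
      t X ((Ext.mk₀ f.hom).comp e (zero_add n)) := by
  rw [translateMap, LinearEquiv.apply_symm_apply]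
  rfl

/-- The Yoneda step: the formula defining `translateMap`, stated at Y = T X, propagates to all Y. It
gives both functoriality and naturality in X. -/
theorem leftDual_comp_translateMap {X X' Y : M.FullSubcategory} (f : X ⟶ X')
    (h : (toInjStable M).obj Y ⟶ (toInjStable M).obj (T X)) (e : Ext.{w} X'.obj Y.obj n) :
    (ht X').leftDual hn Y (h ≫ translateMap hn ht f) e =
      (ht X).leftDual hn Y h ((Ext.mk₀ f.hom).comp e (zero_add n)) := by
  obtain ⟨h, rfl⟩ := (toInjStable M).map_surjective h
  rw [IsARPair.leftDual_comp, leftDual_translateMap, IsARPair.leftDual_map,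
    Ext.comp_assoc_of_third_deg_zero]

/-- The translate as a functor from `M` to the stable category modulo injectives. -/
def translateFunctor : M.FullSubcategory ⥤ InjStable M where
  obj X := (toInjStable M).obj (T X)
  map f := translateMap hn ht f
  map_id X := by
    refine ((ht X).leftDual hn (T X)).injective (LinearMap.ext fun e => ?_)
    rw [leftDual_translateMap, ← (toInjStable M).map_id (T X), IsARPair.leftDual_map]
    change t X ((Ext.mk₀ (𝟙 _)).comp e _) = t X (e.comp (Ext.mk₀ (𝟙 _)) _)
    rw [Ext.mk₀_id_comp, Ext.comp_mk₀_id]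
  map_comp {X X' X''} f g := by
    refine ((ht X'').leftDual hn (T X)).injective (LinearMap.ext fun e => ?_)
    rw [leftDual_translateMap, leftDual_comp_translateMap, leftDual_translateMap,
      Ext.mk₀_comp_mk₀_assoc]
    rfl

/-- Both sides say that `f` and `f'` induce the same functional on Ext^n(X', T X). One direction
makes the functor descend to the quotient, the other makes it faithful. -/
theorem translateMap_eq_iff {X X' : M.FullSubcategory} (f f' : X ⟶ X') :
    translateMap hn ht f = translateMap hn ht f' ↔
      (toProjStable M).map f = (toProjStable M).map f' := by
  rw [(ht X).toProjStable_map_eq_iff hn, ← ((ht X').leftDual hn (T X)).injective.eq_iff,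
    LinearMap.ext_iff]
  simp only [leftDual_translateMap]

/-- The translate as a functor between the stable categories. -/
def stableTranslate : ProjStable M ⥤ InjStable M :=
  CategoryTheory.Quotient.lift _ (translateFunctor hn ht) fun _ _ f f' h =>
    (translateMap_eq_iff hn ht f f').2 (CategoryTheory.Quotient.sound _ h)

theorem stableTranslate_faithful : (stableTranslate hn ht).Faithful where
  map_injective {X X'} f f' h := by
    obtain ⟨X⟩ := X
    obtain ⟨X'⟩ := X'
    obtain ⟨f, rfl⟩ := (toProjStable M).map_surjective f
    obtain ⟨f', rfl⟩ := (toProjStable M).map_surjective f'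
    exact (translateMap_eq_iff hn ht f f').1 h

theorem stableTranslate_full : (stableTranslate hn ht).Full where
  map_surjective {X X'} h := by
    obtain ⟨X⟩ := X
    obtain ⟨X'⟩ := X'
    -- The functional of `h` on Ext^n(X', T X) is also represented on the other side, by a morphism
    -- X → X'.
    obtain ⟨f, hf⟩ := (ht X).surj_right X'.obj ((ht X').leftDual hn (T X) h)
    refine ⟨(toProjStable M).map (ObjectProperty.homMk f), ?_⟩
    refine ((ht X').leftDual hn (T X)).injective (LinearMap.ext fun e => ?_)
    exact (leftDual_translateMap hn ht _ e).trans (hf e)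

include hn in
/-- Two objects which represent the same dual of `Ext^n` are stably isomorphic. -/
theorem IsARPair.nonempty_iso {X V V' : M.FullSubcategory} {t : Ext.{w} X.obj V.obj n →ₗ[R] E}
    (ht : IsARPair t) {t' : Ext.{w} X.obj V'.obj n →ₗ[R] E} (ht' : IsARPair t') :
    Nonempty ((toInjStable M).obj V ≅ (toInjStable M).obj V') := by
  have key {V V' : M.FullSubcategory} {t : Ext.{w} X.obj V.obj n →ₗ[R] E}
      (ht : IsARPair t) {t' : Ext.{w} X.obj V'.obj n →ₗ[R] E} (ht' : IsARPair t')
      (a : V ⟶ V') (ha : ∀ e, t' (e.comp (Ext.mk₀ a.hom) (add_zero n)) = t e)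
      (b : V' ⟶ V) (hb : ∀ e, t (e.comp (Ext.mk₀ b.hom) (add_zero n)) = t' e) :
      (toInjStable M).map a ≫ (toInjStable M).map b = 𝟙 _ := by
    rw [← Functor.map_comp, ← (toInjStable M).map_id V, ht.toInjStable_map_eq_iff hn]
    intro e
    change t (e.comp (Ext.mk₀ (a.hom ≫ b.hom)) _) = t (e.comp (Ext.mk₀ (𝟙 _)) _)
    rw [← Ext.mk₀_comp_mk₀, ← Ext.comp_assoc_of_third_deg_zero, hb, ha, Ext.comp_mk₀_id]
  obtain ⟨a, ha⟩ := ht'.surj_left V.obj t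
  obtain ⟨b, hb⟩ := ht.surj_left V'.obj t'
  exact ⟨⟨(toInjStable M).map (ObjectProperty.homMk a), (toInjStable M).map (ObjectProperty.homMk b),
    key ht ht' _ ha _ hb, key ht' ht _ hb _ ha⟩⟩

theorem stableTranslate_essSurj
    (h : ∀ V : M.FullSubcategory, ∃ (X : M.FullSubcategory)
      (t : Ext.{w} X.obj V.obj n →ₗ[R] E), IsARPair t) :
    (stableTranslate hn ht).EssSurj where
  mem_essImage V := by
    obtain ⟨V⟩ := V
    obtain ⟨X, t', ht'⟩ := h V
    exact ⟨(toProjStable M).obj X, (ht X).nonempty_iso hn ht'⟩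

end Translate

/-! ### Assembling the duality -/

section Main

universe w' w''

variable {A : Type u} [Category.{v} A] [Abelian A] [HasExt.{max u v} A] {n : ℕ}
  {M : ObjectProperty A} {R : Type w'} [CommRing R] [Linear R A] {E : Type w''} [AddCommGroup E]
  [Module R E]

/-- The higher Auslander–Reiten duality for an `n`-cluster tilting subcategory of an abelian
category with enough Nakayama pairs and reflexive extension groups. -/
theorem IsNClusterTilting.exists_translate_equivalence (hM : IsNClusterTilting n M) (hn : 1 ≤ n)
    (hE : Module.Baer R E) (hA : HasEnoughNakayamaPairs A R E)
    (hrefl : ∀ X Y : A, Module.Finite R (Ext.{max u v} X Y n →ₗ[R] E) → Function.Bijective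
      (LinearMap.applyₗ : Ext.{max u v} X Y n →ₗ[R] (Ext.{max u v} X Y n →ₗ[R] E) →ₗ[R] E))
    (hfin : ∀ X Y : A, Module.Finite R (X ⟶ Y)) :
    ∃ (τ : ProjStable M ≌ InjStable M)
      (φ : ∀ X Y : M.FullSubcategory, Ext.{max u v} X.obj Y.obj n ≃ₗ[R]
        (((toInjStable M).obj Y ⟶ τ.functor.obj ((toProjStable M).obj X)) →ₗ[R] E)),
      ∀ (X X' Y Y' : M.FullSubcategory) (f : X' ⟶ X) (g : Y ⟶ Y')
        (e : Ext.{max u v} X.obj Y.obj n)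
        (h : (toInjStable M).obj Y' ⟶ τ.functor.obj ((toProjStable M).obj X')),
        φ X' Y'
            (((Ext.mk₀ f.hom).comp e (zero_add n)).comp (Ext.mk₀ g.hom) (add_zero n)) h =
          φ X Y e ((toInjStable M).map g ≫ h ≫
            τ.functor.map ((toProjStable M).map f)) := by
  have h1 (X : M.FullSubcategory) : ∃ (V : M.FullSubcategory)
      (t : Ext.{max u v} X.obj V.obj n →ₗ[R] E), IsARPair t := by
    obtain ⟨V, t, hV, ht⟩ := hM.exists_translate hn hE hA X.property
    exact ⟨⟨V, hV⟩, t, ht⟩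
  have h2 (V : M.FullSubcategory) : ∃ (X : M.FullSubcategory)
      (t : Ext.{max u v} X.obj V.obj n →ₗ[R] E), IsARPair t := by
    obtain ⟨X, t, hX, ht⟩ := hM.exists_inverse_translate hn hE hA V.property
    exact ⟨⟨X, hX⟩, t, ht⟩
  choose T t ht using h1
  have hn' : 0 < n := hn
  have := stableTranslate_faithful hn' ht
  have := stableTranslate_full hn' ht
  have := stableTranslate_essSurj hn' ht h2
  have : (stableTranslate hn' ht).IsEquivalence := {}
  have hdual (X Y : M.FullSubcategory) :
      Module.Finite R (Ext.{max u v} X.obj Y.obj n →ₗ[R] E) := by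
    have := hfin Y.obj (T X).obj
    -- Finiteness is first obtained for the dual of Ext^n, a quotient of Hom(Y, T X).
    refine Module.Finite.of_surjective (extPairing (t X) Y.obj) fun φ => ?_
    obtain ⟨h, hh⟩ := (ht X).surj_left Y.obj φ
    exact ⟨h, LinearMap.ext hh⟩
  let φ (X Y : M.FullSubcategory) : Ext.{max u v} X.obj Y.obj n ≃ₗ[R]
      (((toInjStable M).obj Y ⟶ (toInjStable M).obj (T X)) →ₗ[R] E) :=
    (LinearEquiv.ofBijective _ (hrefl X.obj Y.obj (hdual X Y))).trans
      (LinearEquiv.arrowCongr ((ht X).leftDual hn' Y).symm (LinearEquiv.refl R E))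
  have hφ (X Y : M.FullSubcategory) (e : Ext.{max u v} X.obj Y.obj n)
      (h : (toInjStable M).obj Y ⟶ (toInjStable M).obj (T X)) :
      φ X Y e h = (ht X).leftDual hn' Y h e := rfl
  refine ⟨(stableTranslate hn' ht).asEquivalence, φ, fun X X' Y Y' f g e h => ?_⟩
  refine (hφ _ _ _ _).trans (Eq.trans ?_ (hφ _ _ _ _).symm)
  refine Eq.trans ?_ ((ht X).leftDual_comp hn' g (h ≫ translateMap hn' ht f) e).symm
  refine Eq.trans ?_ (leftDual_comp_translateMap hn' ht f h _).symm
  exact congrArg _ (Ext.comp_assoc_of_third_deg_zero _ _ _ _)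

end Main

section

open scoped ModuleCat.Algebra

variable {R Λ : Type u} [CommRing R] [Ring Λ] [Algebra R Λ] [IsArtinAlgebra R Λ]

theorem finite_hom_finMod (X Y : FinMod R Λ) : Module.Finite R (X ⟶ Y) := by
  have := IsArtinAlgebra.isArtinianRing (R := R) (Λ := Λ)
  let L : (X ⟶ Y) →ₗ[R] (X.toModule →ₗ[R] Y.toModule) :=
    { toFun := fun f => (FinMod.toLin f).restrictScalars R
      map_add' := fun _ _ => rfl
      map_smul' := fun _ _ => rfl }
  exact Module.Finite.of_injective L
    fun f g h => FinMod.hom_ext fun x => LinearMap.congr_fun h x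

end

end NAR

end

theorem mainTheorem7 (R Λ : Type u) [CommRing R] [Ring Λ] [Algebra R Λ]
    [NAR.IsArtinAlgebra R Λ]
    (E : Type u) [AddCommGroup E] [Module R E] (ι : (R ⧸ Ring.jacobson R) →ₗ[R] E)
    (hι : NAR.IsInjectiveEnvelope ι)
    (n : ℕ) (hn : 1 ≤ n) (M : ObjectProperty (NAR.FinMod R Λ))
    (hM : NAR.IsNClusterTilting n M) :
    ∃ (τ : NAR.ProjStable M ≌ NAR.InjStable M)
      (φ : ∀ X Y : M.FullSubcategory, Ext.{u + 1} X.obj Y.obj n ≃ₗ[R]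
        (((NAR.toInjStable M).obj Y ⟶ τ.functor.obj ((NAR.toProjStable M).obj X)) →ₗ[R] E)),
      ∀ (X X' Y Y' : M.FullSubcategory) (f : X' ⟶ X) (g : Y ⟶ Y')
        (e : Ext.{u + 1} X.obj Y.obj n)
        (h : (NAR.toInjStable M).obj Y' ⟶ τ.functor.obj ((NAR.toProjStable M).obj X')),
        φ X' Y'
            (((Ext.mk₀ f.hom).comp e (zero_add n)).comp (Ext.mk₀ g.hom) (add_zero n)) h =
          φ X Y e ((NAR.toInjStable M).map g ≫ h ≫
            τ.functor.map ((NAR.toProjStable M).map f)) := by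
  have := NAR.IsArtinAlgebra.isArtinianRing (R := R) (Λ := Λ)
  exact hM.exists_translate_equivalence hn (Module.Baer.of_injective hι.injective_module)
    (NAR.hasEnoughNakayamaPairs_finMod hι)
    -- Ext^n embeds in its double dual, so finiteness of the dual passes back to Ext^n, and Matlis
    -- reflexivity applies.
    (fun X Y _ => have := hι.finite_of_dual (Ext.{u + 1} X Y n); hι.bijective_eval _)
    NAR.finite_hom_finMod
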